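/- Let $n \in \mathbb{N}$, $\alpha > 0$ and $\lambda > 0$. Let $X_0$ be a random vector in $\mathbb{R}^n$ that is $\lambda$-strongly log-concave, i.e. it has an everywhere positive density $\rho_0$ with respect to Lebesgue measure such that $\log \rho_0$ is twice differentiable and $-\nabla^2 \log \rho_0(x) \succeq \lambda I$ for all $x \in \mathbb{R}^n$. Let $(X_t)_{t \ge 0}$ be the Ornstein-Uhlenbeck (OU) process $dX = -\alpha X\,dt + \sqrt{2}\,dW$ started from $X_0$, with target measure $\nu = \mathcal{N}(0, \frac{1}{\alpha} I)$; that is, the Markov process whose transition law over a time $t \ge 0$ from a point $x$ is $\mathcal{N}\big(e^{-\alpha t} x, \frac{1 - e^{-2\alpha t}}{\alpha} I\big)$. Let $I(X_0; X_t) \in [0, \infty]$ be the mutual information, i.e. the Kullback-Leibler divergence of the joint law of $(X_0, X_t)$ from the product of its marginals. Put $$t(\lambda) = \begin{cases} 0 & \text{if } \lambda \ge \frac{\alpha}{2}, \\ \frac{1}{2\alpha} \log\left(\frac{\alpha}{\lambda} - 1\right) & \text{if } \lambda < \frac{\alpha}{2}. \end{cases}$$ Then $I(X_0; X_t) < \infty$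 for every $t > 0$, and the function $t \mapsto I(X_0; X_t)$ is convex on $[t(\lambda), \infty)$ (as a $[0,\infty]$-valued function, since $I(X_0; X_0) = \infty$ for $n \ge 1$). -/

import Mathlib

open MeasureTheory ProbabilityTheory
open scoped NNReal ENNReal

noncomputable section

/-- The law at time `t` of the Ornstein-Uhlenbeck flow with target `N(0, I / α)` started from the
point `x`: the Gaussian `N(e^{-α t} x, ((1 - e^{-2 α t}) / α) I)` on `ℝⁿ`. -/
def ouLaw {n : ℕ} (α : ℝ) (t : ℝ≥0) (x : EuclideanSpace ℝ (Fin n)) :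
    Measure (EuclideanSpace ℝ (Fin n)) :=
  (stdGaussian (EuclideanSpace ℝ (Fin n))).map
    (fun z => Real.exp (-α * t) • x + √((1 - Real.exp (-2 * α * t)) / α) • z)

theorem measurable_ouLaw {n : ℕ} (α : ℝ) (t : ℝ≥0) : Measurable (ouLaw (n := n) α t) := by
  have hf : Measurable (fun p : EuclideanSpace ℝ (Fin n) × EuclideanSpace ℝ (Fin n) =>
      Real.exp (-α * t) • p.1 + √((1 - Real.exp (-2 * α * t)) / α) • p.2) := by fun_prop
  refine Measure.measurable_of_measurable_coe _ (fun s hs => ?_)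
  have h : ∀ x, ouLaw (n := n) α t x s = stdGaussian (EuclideanSpace ℝ (Fin n))
      (Prod.mk x ⁻¹' ((fun p : EuclideanSpace ℝ (Fin n) × EuclideanSpace ℝ (Fin n) =>
      Real.exp (-α * t) • p.1 + √((1 - Real.exp (-2 * α * t)) / α) • p.2) ⁻¹' s)) := by
    intro x
    exact Measure.map_apply (by fun_prop) hs
  simp_rw [h]
  exact measurable_measure_prodMk_left (hf hs)

/-- The transition kernel (Mehler kernel) of the Ornstein-Uhlenbeck process
`dX = -α X dt + √2 dW` over a time span `t`. -/
def ouKernel (n : ℕ) (α : ℝ) (t : ℝ≥0) :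
    Kernel (EuclideanSpace ℝ (Fin n)) (EuclideanSpace ℝ (Fin n)) where
  toFun := ouLaw α t
  measurable' := measurable_ouLaw α t

instance isMarkovKernel_ouKernel (n : ℕ) (α : ℝ) (t : ℝ≥0) : IsMarkovKernel (ouKernel n α t) where
  isProbabilityMeasure x := by
    change IsProbabilityMeasure (ouLaw α t x)
    exact Measure.isProbabilityMeasure_map (by fun_prop)

/-- `X` is an Ornstein-Uhlenbeck process in `ℝⁿ` with target measure `N(0, I / α)` (and arbitrary
initial law): a Markov process (with respect to its own past) whose transition kernels are the
Ornstein-Uhlenbeck kernels. Given `(X_r)_{r ≤ s}`, the variable `X_{s+h}` is distributed as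
`N(e^{-α h} X_s, ((1 - e^{-2 α h}) / α) I)`. -/
structure IsOUProcess {n : ℕ} {Ω : Type*} [MeasurableSpace Ω] (α : ℝ)
    (X : ℝ≥0 → Ω → EuclideanSpace ℝ (Fin n)) (P : Measure Ω) : Prop where
  measurable : ∀ t, Measurable (X t)
  markov : ∀ s h : ℝ≥0,
    HasCondDistrib (X (s + h)) (fun ω (r : Set.Iic s) => X r ω)
      ((ouKernel n α h).comap
        (fun p : Set.Iic s → EuclideanSpace ℝ (Fin n) => p ⟨s, Set.self_mem_Iic⟩)
        (measurable_pi_apply _)) P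

/-- `μ` has an everywhere positive Lebesgue density `ρ` on `ℝⁿ` such that `log ρ` is twice
differentiable and `-∇² log ρ(x) ⪰ lam • I` for every `x`. -/
def IsStronglyLogConcave {n : ℕ} (lam : ℝ) (μ : Measure (EuclideanSpace ℝ (Fin n))) : Prop :=
  ∃ ρ : EuclideanSpace ℝ (Fin n) → ℝ,
    (∀ x, 0 < ρ x) ∧
    μ = volume.withDensity (fun x => ENNReal.ofReal (ρ x)) ∧
    Differentiable ℝ (fun x => Real.log (ρ x)) ∧
    Differentiable ℝ (fderiv ℝ (fun x => Real.log (ρ x))) ∧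
    ∀ x v, lam * ‖v‖ ^ 2 ≤ -(fderiv ℝ (fderiv ℝ (fun y => Real.log (ρ y))) x v v)

/-- Mutual information `I(X; Y) ∈ [0, ∞]`: the Kullback-Leibler divergence of the joint law of
`(X, Y)` from the product of the two marginal laws. -/
def mutualInfo {Ω S T : Type*} [MeasurableSpace Ω] [MeasurableSpace S] [MeasurableSpace T]
    (X : Ω → S) (Y : Ω → T) (P : Measure Ω) : ℝ≥0∞ :=
  InformationTheory.klDiv (P.map (fun ω => (X ω, Y ω))) ((P.map X).prod (P.map Y))

/-- The time threshold `t(lam)`. -/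
def convexityTime (α lam : ℝ) : ℝ :=
  if α / 2 ≤ lam then 0 else 1 / (2 * α) * Real.log (α / lam - 1)

end

/-! Up to a nonzero scalar, `X_t` is in law the observation `√s X_0 + Z` of the signal `X_0` in
standard Gaussian noise, at signal-to-noise ratio `s = α / (e^{2αt} - 1)`. So `I(X_0; X_t)` is the
information of a Gaussian channel. The I-MMSE formula `dI/dr = r * mmse(r)`, with `s = r²`, and
`ds/dt = -2s(s + α)` give `dI/dt = -s(s + α) mmse(√s)`. As `s` decreases in `t`, convexity means
that `s(s + α) mmse(√s)` is nondecreasing in `s`. It is the product of `s / (λ + s)`, of `s + α` and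
of `(λ + s) mmse(√s)`; the first two factors are clearly nondecreasing, and the third is by
`IsMidpointLogConcave.mul_mmse_le`. This gives convexity on all of `(0, ∞)`; the endpoint `0` costs
nothing because the information is infinite there when `n ≥ 1`.

The heart is the monotonicity of `(λ + s) mmse(√s)`. Infinitesimally it expresses that the posterior
covariance is at most `(λ + s)⁻¹`, but the proof works with finite increments. An observation at
ratio `q²` splits into independent ones at ratios `r²` and `h² = q² - r²`, and given the first one
the signal is `(λ + r²)`-strongly log-concave (`IsMidpointLogConcave.tilted_logLik`). It remains to
see that, for a `κ`-strongly log-concave signal, the posterior mean at ratio `h²` retains at most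
the fraction `h² / (κ + h²)` of the variance (`IsMidpointLogConcave.variance_postAvg_le`). By
duality this is a bound on the variance of `f(x) = 𝔼 g(h x + Z)`. Poincaré's inequality gives `κ Var
f ≤ 𝔼 ‖∇f‖²`, Bessel's inequality in Gaussian space gives `‖∇f(x)‖² ≤ h² Var(g(Y) | X = x)`, and the
law of total variance closes the estimate.

Poincaré's inequality comes from Prékopa-Leindler: the latter yields Maurey's property (τ), whose
second order expansion around constants is Poincaré. Only midpoint convexity of the potential
enters. -/

set_option linter.unusedSectionVars false

/-! ### The standard Gaussian and the additive Gaussian channel. -/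

section Gaussian

variable {E : Type*} [NormedAddCommGroup E] [InnerProductSpace ℝ E] [FiniteDimensional ℝ E]
  [MeasurableSpace E] [BorelSpace E]

theorem integrable_exp_neg_half_sq_norm :
    Integrable (fun z : E => Real.exp (-(1 / 2) * ‖z‖ ^ 2)) := by
  have h := GaussianFourier.integrable_cexp_neg_mul_sq_norm_add (V := E) (b := 1 / 2)
    (by norm_num) 0 0
  refine h.norm.congr (Filter.Eventually.of_forall fun z => ?_)
  simp only [zero_mul, add_zero, Complex.norm_exp]
  congr 1
  rw [show (-(1 / 2) : ℂ) * (‖z‖ : ℂ) ^ 2 = ((-(1 / 2) * ‖z‖ ^ 2 : ℝ) : ℂ) by push_cast; ring,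
    Complex.ofReal_re]

/-- Both sides have the same characteristic function. The explicit density reduces the
Cameron-Martin formula to translation invariance of Lebesgue measure. -/
theorem stdGaussian_eq_tilted :
    stdGaussian E = (volume : Measure E).tilted (fun z => -(1 / 2) * ‖z‖ ^ 2) := by
  have hint := integrable_exp_neg_half_sq_norm (E := E)
  have : IsProbabilityMeasure ((volume : Measure E).tilted (fun z => -(1 / 2) * ‖z‖ ^ 2)) :=
    isProbabilityMeasure_tilted hint
  refine Measure.ext_of_charFun (funext fun t => ?_)
  rw [charFun_stdGaussian, charFun_apply, integral_tilted]
  have hpos := integral_exp_pos (μ := (volume : Measure E)) hint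
  have h0 := GaussianFourier.integral_cexp_neg_mul_sq_norm_add (V := E) (b := 1 / 2)
    (by norm_num) Complex.I t
  have h1 := GaussianFourier.integral_cexp_neg_mul_sq_norm_add (V := E) (b := 1 / 2)
    (by norm_num) 0 0
  have h2 : ((∫ z : E, Real.exp (-(1 / 2) * ‖z‖ ^ 2) : ℝ) : ℂ)
      = (Real.pi / (1 / 2 : ℂ)) ^ (Module.finrank ℝ E / 2 : ℂ) := by
    have e : ∫ z : E, Complex.exp (-(1 / 2) * ‖z‖ ^ 2 + 0 * (inner ℝ (0 : E) z : ℝ))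
        = ((∫ z : E, Real.exp (-(1 / 2) * ‖z‖ ^ 2) : ℝ) : ℂ) := by
      rw [← integral_complex_ofReal]
      congr with z
      push_cast
      simp
    rw [← e, h1]
    simp
  have h3 : ∀ z : E, (Real.exp (-(1 / 2) * ‖z‖ ^ 2) / ∫ x : E, Real.exp (-(1 / 2) * ‖x‖ ^ 2)) •
      Complex.exp ((inner ℝ z t : ℝ) * Complex.I) =
      ((∫ x : E, Real.exp (-(1 / 2) * ‖x‖ ^ 2) : ℝ) : ℂ)⁻¹ *
      Complex.exp (-(1 / 2) * ‖z‖ ^ 2 + Complex.I * (inner ℝ t z : ℝ)) := by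
    intro z
    rw [Complex.exp_add, Complex.real_smul, real_inner_comm]
    push_cast
    ring_nf
  simp_rw [h3]
  rw [integral_const_mul, h0, ← h2, ← mul_assoc, inv_mul_cancel₀ (by exact_mod_cast hpos.ne'),
    one_mul, Complex.I_sq]
  congr 1
  ring

/-- Cameron-Martin formula for the standard Gaussian. -/
theorem lintegral_stdGaussian_add (a : E) {g : E → ℝ≥0∞} :
    ∫⁻ z, g (a + z) ∂(stdGaussian E)
      = ∫⁻ z, ENNReal.ofReal (Real.exp (inner ℝ a z - ‖a‖ ^ 2 / 2)) * g z ∂(stdGaussian E) := by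
  rw [stdGaussian_eq_tilted, lintegral_tilted, lintegral_tilted]
  conv_rhs => rw [← lintegral_add_left_eq_self _ a]
  refine lintegral_congr fun z => ?_
  rw [← mul_assoc, ← ENNReal.ofReal_mul (by positivity), div_mul_eq_mul_div, ← Real.exp_add]
  congr 4
  rw [norm_add_sq_real, inner_add_right, real_inner_self_eq_norm_sq]
  ring

/-- Merges the noises of two independent observations into one standard noise. -/
theorem map_rotation_stdGaussian {a b : ℝ} (hab : a ^ 2 + b ^ 2 = 1) :
    ((stdGaussian E).prod (stdGaussian E)).map (fun p => a • p.1 + b • p.2) = stdGaussian E := by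
  have h : (fun p : E × E => a • p.1 + b • p.2)
      = (fun p : E × E => p.1 + p.2) ∘ Prod.map (a • ·) (b • ·) := rfl
  have h1 : IsProbabilityMeasure ((stdGaussian E).map (a • · : E → E)) :=
    Measure.isProbabilityMeasure_map (by fun_prop)
  have h2 : IsProbabilityMeasure ((stdGaussian E).map (b • · : E → E)) :=
    Measure.isProbabilityMeasure_map (by fun_prop)
  rw [h, ← Measure.map_map (by fun_prop) (by fun_prop), ← Measure.map_prod_map _ _ (by fun_prop)
    (by fun_prop)]
  have : IsProbabilityMeasure ((((stdGaussian E).map (a • · : E → E)).prod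
      ((stdGaussian E).map (b • · : E → E))).map (fun p : E × E => p.1 + p.2)) :=
    Measure.isProbabilityMeasure_map (by fun_prop)
  refine Measure.ext_of_charFun (funext fun t => ?_)
  rw [charFun_map_add_prod_eq_mul]
  simp only [Pi.mul_apply, charFun_map_smul, charFun_stdGaussian, norm_smul, ← Complex.exp_add]
  congr 1
  push_cast
  have ha : ((|a| : ℝ) : ℂ) ^ 2 = (a : ℂ) ^ 2 := by exact_mod_cast sq_abs a
  have hb : ((|b| : ℝ) : ℂ) ^ 2 = (b : ℂ) ^ 2 := by exact_mod_cast sq_abs b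
  have hab' : (a : ℂ) ^ 2 + (b : ℂ) ^ 2 = 1 := by exact_mod_cast hab
  simp only [Real.norm_eq_abs, mul_pow, ha, hb]
  linear_combination -(‖t‖ : ℂ) ^ 2 / 2 * hab'

theorem integrable_norm_sq_stdGaussian :
    Integrable (fun z : E => ‖z‖ ^ 2) (stdGaussian E) :=
  (IsGaussian.memLp_two_id (μ := stdGaussian E)).integrable_norm_pow (by norm_num)

/-- The logarithm of the likelihood ratio, with respect to the standard Gaussian, of an observation
`y = r • x + z` of the signal `x` in standard Gaussian noise. -/
noncomputable def logLik (r : ℝ) (y x : E) : ℝ := r * inner ℝ x y - r ^ 2 * ‖x‖ ^ 2 / 2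

@[fun_prop]
theorem measurable_logLik_uncurry (r : ℝ) : Measurable (fun p : E × E => logLik r p.2 p.1) := by
  unfold logLik
  fun_prop

@[fun_prop]
theorem measurable_logLik (r : ℝ) (y : E) : Measurable (logLik r y) := by
  unfold logLik
  fun_prop

/-- Completing the square, the log-likelihood is `‖y‖² / 2 - ‖y - r x‖² / 2`. For fixed `y` the
likelihood is therefore bounded in `x`, so tilting by it preserves integrability. -/
theorem logLik_le (r : ℝ) (y x : E) : logLik r y x ≤ ‖y‖ ^ 2 / 2 := by
  unfold logLik
  have h := sq_nonneg ‖y - r • x‖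
  rw [norm_sub_sq_real, inner_smul_right, norm_smul, mul_pow, Real.norm_eq_abs, sq_abs,
    real_inner_comm] at h
  linarith

/-- Two independent observations of one signal are equivalent to a single one: the combination on
the right is a sufficient statistic. -/
theorem logLik_add {r h q : ℝ} (hq : q ≠ 0) (hrh : r ^ 2 + h ^ 2 = q ^ 2) (y z x : E) :
    logLik r y x + logLik h z x = logLik q ((r / q) • y + (h / q) • z) x := by
  unfold logLik
  rw [inner_add_right, inner_smul_right, inner_smul_right, ← hrh]
  field_simp
  ring

/-- The joint law of a signal and of its noisy observation. -/
noncomputable def channelLaw (μ : Measure E) (r : ℝ) : Measure (E × E) :=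
  (μ.prod (stdGaussian E)).map (fun p => (p.1, r • p.1 + p.2))

instance isProbabilityMeasure_channelLaw (μ : Measure E) [IsProbabilityMeasure μ] (r : ℝ) :
    IsProbabilityMeasure (channelLaw μ r) :=
  Measure.isProbabilityMeasure_map (by fun_prop)

/-- Cameron-Martin with shift `r • x` on each fibre over the signal `x`. -/
theorem channelLaw_eq_withDensity (μ : Measure E) [IsProbabilityMeasure μ] (r : ℝ) :
    channelLaw μ r = (μ.prod (stdGaussian E)).withDensity
      (fun p => ENNReal.ofReal (Real.exp (logLik r p.2 p.1))) := by
  refine Measure.ext_of_lintegral _ fun g hg => ?_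
  rw [channelLaw, lintegral_map hg (by fun_prop), lintegral_withDensity_eq_lintegral_mul _
    (by fun_prop) hg, lintegral_prod _ (by fun_prop), lintegral_prod _ (by fun_prop)]
  refine lintegral_congr fun x => ?_
  rw [lintegral_stdGaussian_add (r • x) (g := fun y => g (x, y))]
  refine lintegral_congr fun y => ?_
  simp only [Pi.mul_apply, logLik, inner_smul_left, norm_smul, mul_pow, Real.norm_eq_abs, sq_abs]
  rfl

end Gaussian

/-! ### The Prékopa-Leindler inequality for midpoints. -/

section PrekopaLeindler

/-- The Brunn-Minkowski inequality on the line, for midpoints. -/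
theorem Real.volume_add_volume_le_of_midpoint {A B C : Set ℝ} (hA : MeasurableSet A)
    (hB : MeasurableSet B) (hAne : A.Nonempty) (hBne : B.Nonempty)
    (h : ∀ a ∈ A, ∀ b ∈ B, (1 / 2 : ℝ) * (a + b) ∈ C) :
    volume A + volume B ≤ 2 * volume C := by
  have key : ∀ K L : Set ℝ, IsCompact K → IsCompact L → K.Nonempty → L.Nonempty → K ⊆ A → L ⊆ B →
      volume K + volume L ≤ 2 * volume C := by
    intro K L hK hL hKne hLne hKA hLB
    -- The half-sums of `K` with `l = min L` lie to the left of `c`, those of `L` with `k = max K`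
    -- to its right, so the two translated copies overlap at most in a point.
    set k := sSup K
    set l := sInf L
    have hk : k ∈ K := hK.sSup_mem hKne
    have hl : l ∈ L := hL.sInf_mem hLne
    set c := (1 / 2 : ℝ) * (k + l)
    have hpre : ∀ (S : Set ℝ) (u : ℝ), volume ((fun x => (1 / 2 : ℝ) * (x + u)) ⁻¹' S)
        = 2 * volume S := by
      intro S u
      have : (fun x : ℝ => (1 / 2 : ℝ) * (x + u)) ⁻¹' S
          = (fun x => x + u) ⁻¹' ((fun x => (1 / 2 : ℝ) * x) ⁻¹' S) := rfl
      rw [this, measure_preimage_add_right, Real.volume_preimage_mul_left (by norm_num)]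
      norm_num
    have h1 : volume K ≤ 2 * volume (C ∩ Set.Iic c) := by
      rw [← hpre _ l]
      refine measure_mono fun x hx => ⟨h x (hKA hx) l (hLB hl), ?_⟩
      have : x ≤ k := le_csSup hK.bddAbove hx
      simp only [Set.mem_Iic, c]
      linarith
    have h2 : volume L ≤ 2 * volume (C ∩ Set.Ici c) := by
      rw [← hpre _ k]
      refine measure_mono fun x hx => ⟨?_, ?_⟩
      · have := h k (hKA hk) x (hLB hx)
        rwa [add_comm] at this
      · have : l ≤ x := csInf_le hL.bddBelow hx
        simp only [Set.mem_Ici, c]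
        linarith
    have h3 : volume (C ∩ Set.Ici c) = volume (C ∩ Set.Ioi c) :=
      measure_congr ((ae_eq_refl C).inter Ioi_ae_eq_Ici.symm)
    have h4 : volume (C ∩ Set.Iic c) + volume (C ∩ Set.Ioi c) = volume C := by
      have := measure_inter_add_sdiff (μ := volume) C (measurableSet_Iic (a := c))
      rwa [Set.sdiff_eq, Set.compl_Iic] at this
    calc volume K + volume L ≤ 2 * volume (C ∩ Set.Iic c) + 2 * volume (C ∩ Set.Ici c) :=
          add_le_add h1 h2
      _ = 2 * volume C := by rw [h3, ← mul_add, h4]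
  obtain ⟨a, ha⟩ := hAne
  obtain ⟨b, hb⟩ := hBne
  rw [hA.measure_eq_iSup_isCompact, hB.measure_eq_iSup_isCompact]
  simp_rw [iSup_and']
  refine ENNReal.biSup_add_biSup_le' ⟨∅, by simp⟩ ⟨∅, by simp⟩ fun K hK L hL => ?_
  -- The inner approximating compacts may be empty; adding a point repairs this.
  calc volume K + volume L ≤ volume (K ∪ {a}) + volume (L ∪ {b}) :=
        add_le_add (measure_mono Set.subset_union_left) (measure_mono Set.subset_union_left)
    _ ≤ _ := key _ _ (hK.2.union isCompact_singleton) (hL.2.union isCompact_singleton)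
        ⟨a, by simp⟩ ⟨b, by simp⟩ (Set.union_subset hK.1 (by simpa))
        (Set.union_subset hL.1 (by simpa))

/-- Integrate Brunn-Minkowski over the level sets. Since `f` and `g` both have supremum one, their
sets above level `t` are both nonempty for `t < 1` and both empty for `t ≥ 1`; Brunn-Minkowski would
fail if just one were empty. -/
theorem lintegral_add_lintegral_le_of_midpoint {f g h : ℝ → ℝ} (hf : Measurable f)
    (hg : Measurable g) (hh : Measurable h) (hf0 : ∀ x, 0 ≤ f x) (hg0 : ∀ x, 0 ≤ g x)
    (hh0 : ∀ x, 0 ≤ h x) (hf1 : ∀ x, f x ≤ 1) (hg1 : ∀ x, g x ≤ 1)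
    (hfs : ∀ t < 1, ∃ x, t < f x) (hgs : ∀ t < 1, ∃ x, t < g x)
    (H : ∀ x y, f x * g y ≤ h ((1 / 2 : ℝ) * (x + y)) ^ 2) :
    (∫⁻ x, ENNReal.ofReal (f x)) + ∫⁻ x, ENNReal.ofReal (g x)
      ≤ 2 * ∫⁻ x, ENNReal.ofReal (h x) := by
  rw [lintegral_eq_lintegral_meas_lt _ (Filter.Eventually.of_forall hf0) hf.aemeasurable,
    lintegral_eq_lintegral_meas_lt _ (Filter.Eventually.of_forall hg0) hg.aemeasurable,
    lintegral_eq_lintegral_meas_lt _ (Filter.Eventually.of_forall hh0) hh.aemeasurable]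
  have hanti : ∀ u : ℝ → ℝ, Measurable fun t : ℝ => volume {x | t < u x} := fun u =>
    Antitone.measurable fun s t hst => measure_mono fun x (hx : t < u x) => lt_of_le_of_lt hst hx
  rw [← lintegral_add_left (hanti f), ← lintegral_const_mul _ (hanti h)]
  refine setLIntegral_mono ((hanti h).const_mul _) fun t ht => ?_
  rcases lt_or_ge t 1 with ht1 | ht1
  · refine Real.volume_add_volume_le_of_midpoint (measurableSet_lt measurable_const hf)
      (measurableSet_lt measurable_const hg)
      (hfs t ht1) (hgs t ht1) fun a ha b hb => ?_
    have ht0 : 0 < t := ht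
    have ha' : t < f a := ha
    have hb' : t < g b := hb
    have := H a b
    have h1 : t ^ 2 < h ((1 / 2 : ℝ) * (a + b)) ^ 2 := by nlinarith
    exact lt_of_pow_lt_pow_left₀ 2 (hh0 _) h1
  · have e1 : {x | t < f x} = ∅ := by
      ext x; simpa using (hf1 x).trans ht1
    have e2 : {x | t < g x} = ∅ := by
      ext x; simpa using (hg1 x).trans ht1
    simp [e1, e2]

theorem ENNReal.mul_le_sq_of_add_le {a b c : ℝ≥0∞} (h : a + b ≤ 2 * c) : a * b ≤ c ^ 2 := by
  rcases eq_or_ne c ∞ with rfl | hc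
  · simp
  have hc2 : 2 * c ≠ ∞ := ENNReal.mul_ne_top (by simp) hc
  have ha : a ≠ ∞ := ne_top_of_le_ne_top hc2 (le_self_add.trans h)
  have hb : b ≠ ∞ := ne_top_of_le_ne_top hc2 (le_add_self.trans h)
  lift a to ℝ≥0 using ha
  lift b to ℝ≥0 using hb
  lift c to ℝ≥0 using hc
  norm_cast at h ⊢
  have h' : (a : ℝ) + b ≤ 2 * c := by exact_mod_cast h
  have : (a : ℝ) * b ≤ c ^ 2 := by
    nlinarith [sq_nonneg ((a : ℝ) - b), a.2, b.2, c.2]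
  exact_mod_cast this

/-- The measure `μ` satisfies the midpoint form of the Prékopa-Leindler inequality. -/
def SatisfiesPrekopaLeindler {V : Type*} [AddCommGroup V] [Module ℝ V] [MeasurableSpace V]
    (μ : Measure V) : Prop :=
  ∀ F G H : V → ℝ≥0∞, Measurable F → Measurable G → Measurable H →
    (∀ x y, F x * G y ≤ H ((1 / 2 : ℝ) • (x + y)) ^ 2) →
    (∫⁻ x, F x ∂μ) * (∫⁻ x, G x ∂μ) ≤ (∫⁻ x, H x ∂μ) ^ 2

/-- Tensorisation: the inequality on the fibres says that the partial integrals again satisfy the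
midpoint hypothesis on the base. -/
theorem SatisfiesPrekopaLeindler.prod {V W : Type*} [AddCommGroup V] [Module ℝ V]
    [MeasurableSpace V] [AddCommGroup W] [Module ℝ W] [MeasurableSpace W] {μ : Measure V}
    {ν : Measure W} [SFinite μ] [SFinite ν] (hμ : SatisfiesPrekopaLeindler μ)
    (hν : SatisfiesPrekopaLeindler ν) : SatisfiesPrekopaLeindler (μ.prod ν) := by
  intro F G H hF hG hH h
  rw [lintegral_prod _ hF.aemeasurable, lintegral_prod _ hG.aemeasurable,
    lintegral_prod _ hH.aemeasurable]
  refine hμ _ _ _ hF.lintegral_prod_right' hG.lintegral_prod_right' hH.lintegral_prod_right'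
    fun x y => ?_
  exact hν _ _ _ (hF.comp measurable_prodMk_left) (hG.comp measurable_prodMk_left)
    (hH.comp measurable_prodMk_left) fun u v => h (x, u) (y, v)

theorem SatisfiesPrekopaLeindler.of_measurePreserving {V W : Type*} [AddCommGroup V] [Module ℝ V]
    [MeasurableSpace V] [AddCommGroup W] [Module ℝ W] [MeasurableSpace W] {μ : Measure V}
    {ν : Measure W} {e : V → W} (he : MeasurePreserving e μ ν)
    (hmid : ∀ x y, e ((1 / 2 : ℝ) • (x + y)) = (1 / 2 : ℝ) • (e x + e y))
    (hμ : SatisfiesPrekopaLeindler μ) : SatisfiesPrekopaLeindler ν := by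
  intro F G H hF hG hH h
  rw [← he.lintegral_comp hF, ← he.lintegral_comp hG, ← he.lintegral_comp hH]
  refine hμ _ _ _ (hF.comp he.measurable) (hG.comp he.measurable) (hH.comp he.measurable)
    fun x y => ?_
  rw [hmid]
  exact h _ _

theorem satisfiesPrekopaLeindler_real : SatisfiesPrekopaLeindler (volume : Measure ℝ) := by
  -- functions with finite suprema first, normalised to have supremum one
  have bdd : ∀ F G H : ℝ → ℝ≥0∞, Measurable F → Measurable G → Measurable H →
      (⨆ x, F x) ≠ ∞ → (⨆ x, G x) ≠ ∞ →
      (∀ x y, F x * G y ≤ H ((1 / 2 : ℝ) • (x + y)) ^ 2) →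
      (∫⁻ x, F x) * (∫⁻ x, G x) ≤ (∫⁻ x, H x) ^ 2 := by
    intro F G H hF hG hH hFb hGb h
    set a := ⨆ x, F x with ha
    set b := ⨆ x, G x with hb
    have hFa : ∀ x, F x ≤ a := le_iSup F
    have hGb' : ∀ x, G x ≤ b := le_iSup G
    rcases eq_or_ne a 0 with ha0 | ha0
    · have : ∀ x, F x = 0 := fun x => le_antisymm (ha0 ▸ hFa x) zero_le
      simp [this]
    rcases eq_or_ne b 0 with hb0 | hb0
    · have : ∀ x, G x = 0 := fun x => le_antisymm (hb0 ▸ hGb' x) zero_le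
      simp [this]
    have hai : a⁻¹ ≠ ∞ := ENNReal.inv_ne_top.2 ha0
    have hbi : b⁻¹ ≠ ∞ := ENNReal.inv_ne_top.2 hb0
    have hai0 : a⁻¹ ≠ 0 := ENNReal.inv_ne_zero.2 hFb
    have hbi0 : b⁻¹ ≠ 0 := ENNReal.inv_ne_zero.2 hGb
    -- Dividing `F` by `a` and `G` by `b` preserves the midpoint hypothesis once `H` is divided by
    -- `√(ab)`.
    set c := (a⁻¹ * b⁻¹) ^ (1 / 2 : ℝ) with hc
    have hc2 : c ^ 2 = a⁻¹ * b⁻¹ := by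
      rw [hc, ← ENNReal.rpow_natCast, ← ENNReal.rpow_mul]
      norm_num
    have norm_le : ∀ (s : ℝ≥0∞) (U : ℝ → ℝ≥0∞), s ≠ 0 → s ≠ ∞ → (∀ x, U x ≤ s) →
        ∀ x, s⁻¹ * U x ≤ 1 := fun s U h0 ht hU x => by
      calc s⁻¹ * U x ≤ s⁻¹ * s := by gcongr; exact hU x
        _ = 1 := ENNReal.inv_mul_cancel h0 ht
    have sup_one : ∀ (s : ℝ≥0∞) (U : ℝ → ℝ≥0∞), s ≠ 0 → s ≠ ∞ → s = (⨆ x, U x) →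
        ∀ t : ℝ, t < 1 → ∃ x, t < (s⁻¹ * U x).toReal := by
      intro s U h0 htop hs t ht
      have hle := norm_le s U h0 htop (fun x => hs ▸ le_iSup U x)
      have h1 : (⨆ x, s⁻¹ * U x) = 1 := by
        rw [← ENNReal.mul_iSup, ← hs, ENNReal.inv_mul_cancel h0 htop]
      have h2 : ENNReal.ofReal t < ⨆ x, s⁻¹ * U x := by
        rw [h1]
        simpa using ht
      obtain ⟨x, hx⟩ := lt_iSup_iff.1 h2
      refine ⟨x, ?_⟩
      have hne : s⁻¹ * U x ≠ ∞ := ne_top_of_le_ne_top (by simp) (hle x)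
      rcases lt_or_ge t 0 with h0' | h0'
      · exact h0'.trans_le ENNReal.toReal_nonneg
      · exact (ENNReal.ofReal_lt_iff_lt_toReal h0' hne).1 hx
    have hF1 := norm_le a F ha0 hFb hFa
    have hG1 := norm_le b G hb0 hGb hGb'
    have hFt : ∀ x, a⁻¹ * F x ≠ ∞ := fun x => ne_top_of_le_ne_top (by simp) (hF1 x)
    have hGt : ∀ x, b⁻¹ * G x ≠ ∞ := fun x => ne_top_of_le_ne_top (by simp) (hG1 x)
    have hHt : ∀ x, min (c * H x) 1 ≠ ∞ := fun x => ne_top_of_le_ne_top (by simp) (min_le_right _ _)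
    -- Capping `c * H` at one makes it real-valued and costs nothing, the normalised `F` and `G`
    -- being at most one.
    have main := lintegral_add_lintegral_le_of_midpoint
      (f := fun x => (a⁻¹ * F x).toReal) (g := fun x => (b⁻¹ * G x).toReal)
      (h := fun x => (min (c * H x) 1).toReal) (by fun_prop) (by fun_prop) (by fun_prop)
      (fun _ => ENNReal.toReal_nonneg) (fun _ => ENNReal.toReal_nonneg)
      (fun _ => ENNReal.toReal_nonneg)
      (fun x => ENNReal.toReal_le_of_le_ofReal zero_le_one (by simpa using hF1 x))
      (fun x => ENNReal.toReal_le_of_le_ofReal zero_le_one (by simpa using hG1 x))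
      (sup_one a F ha0 hFb ha) (sup_one b G hb0 hGb hb) (by
        intro x y
        rw [← ENNReal.toReal_mul, ← ENNReal.toReal_pow]
        refine ENNReal.toReal_mono (ENNReal.pow_ne_top (hHt _)) ?_
        have e1 : a⁻¹ * F x * (b⁻¹ * G y) ≤ (c * H ((1 / 2 : ℝ) * (x + y))) ^ 2 := by
          rw [mul_pow, hc2, mul_mul_mul_comm]
          gcongr
          exact h x y
        have e2 : a⁻¹ * F x * (b⁻¹ * G y) ≤ 1 ^ 2 := by
          calc a⁻¹ * F x * (b⁻¹ * G y) ≤ 1 * 1 := mul_le_mul' (hF1 x) (hG1 y)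
            _ = 1 ^ 2 := by simp
        rcases min_choice (c * H ((1 / 2 : ℝ) * (x + y))) 1 with hm | hm <;> rw [hm]
        exacts [e1, e2])
    simp only [ENNReal.ofReal_toReal (hFt _), ENNReal.ofReal_toReal (hGt _),
      ENNReal.ofReal_toReal (hHt _)] at main
    rw [lintegral_const_mul _ hF, lintegral_const_mul _ hG] at main
    have main2 := ENNReal.mul_le_sq_of_add_le (main.trans (by
      gcongr 2 * ?_
      calc (∫⁻ x, min (c * H x) 1) ≤ ∫⁻ x, c * H x := lintegral_mono fun x => min_le_left _ _
        _ = c * ∫⁻ x, H x := lintegral_const_mul _ hH))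
    rw [mul_pow, hc2, mul_mul_mul_comm] at main2
    exact (ENNReal.mul_le_mul_iff_right (mul_ne_zero hai0 hbi0)
      (ENNReal.mul_ne_top hai hbi)).1 main2
  intro F G H hF hG hH h
  -- Unbounded `F` and `G` are reached by monotone convergence; truncating them only helps the
  -- midpoint hypothesis.
  have htrunc : ∀ U : ℝ → ℝ≥0∞, Measurable U →
      ∫⁻ x, U x = ⨆ N : ℕ, ∫⁻ x, min (U x) N := by
    intro U hU
    rw [← lintegral_iSup (fun N => hU.min measurable_const)
      (fun i j hij x => min_le_min_left _ (by exact_mod_cast hij))]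
    refine lintegral_congr fun x => ?_
    rw [← inf_iSup_eq, ENNReal.iSup_natCast, inf_top_eq]
  have hb : ∀ (U : ℝ → ℝ≥0∞) (N : ℕ), (⨆ x, min (U x) N) ≠ ∞ := fun U N =>
    ne_top_of_le_ne_top (ENNReal.natCast_ne_top N) (iSup_le fun x => min_le_right _ _)
  rw [htrunc F hF, htrunc G hG, ENNReal.iSup_mul]
  refine iSup_le fun N => ?_
  rw [ENNReal.mul_iSup]
  refine iSup_le fun M => ?_
  refine bdd _ _ H (hF.min measurable_const) (hG.min measurable_const) hH (hb F N) (hb G M)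
    fun x y => ?_
  exact (mul_le_mul' (min_le_left _ _) (min_le_left _ _)).trans (h x y)

theorem satisfiesPrekopaLeindler_pi (n : ℕ) :
    SatisfiesPrekopaLeindler (volume : Measure (Fin n → ℝ)) := by
  induction n with
  | zero =>
    intro F G H hF hG hH h
    simp only [Measure.volume_pi_eq_dirac (x := (0 : Fin 0 → ℝ)), lintegral_dirac]
    simpa using h 0 0
  | succ n ih =>
    have he := (volume_preserving_piFinSuccAbove (fun _ : Fin (n + 1) => ℝ) 0).symm
    refine (satisfiesPrekopaLeindler_real.prod ih).of_measurePreserving he fun x y => ?_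
    ext i
    refine Fin.cases ?_ (fun j => ?_) i <;> simp [MeasurableEquiv.piFinSuccAbove] <;> ring

theorem satisfiesPrekopaLeindler_euclideanSpace (n : ℕ) :
    SatisfiesPrekopaLeindler (volume : Measure (EuclideanSpace ℝ (Fin n))) :=
  (satisfiesPrekopaLeindler_pi n).of_measurePreserving (PiLp.volume_preserving_toLp (Fin n))
    fun x y => by ext; simp; ring

theorem satisfiesPrekopaLeindler_volume {E : Type*} [NormedAddCommGroup E]
    [InnerProductSpace ℝ E] [FiniteDimensional ℝ E] [MeasurableSpace E] [BorelSpace E] :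
    SatisfiesPrekopaLeindler (volume : Measure E) :=
  (satisfiesPrekopaLeindler_euclideanSpace _).of_measurePreserving
    (stdOrthonormalBasis ℝ E).repr.symm.measurePreserving fun x y => by simp

end PrekopaLeindler

/-! ### Property (τ), moments and Poincaré's inequality for strongly log-concave measures. -/

section LogConcave

variable {E : Type*} [NormedAddCommGroup E] [InnerProductSpace ℝ E] [FiniteDimensional ℝ E]
  [MeasurableSpace E] [BorelSpace E]

/-- `ν` has density `exp (-W)` with respect to the volume, where `W - κ / 2 * ‖·‖ ^ 2` is midpoint
convex. -/
def IsMidpointLogConcave (κ : ℝ) (ν : Measure E) : Prop :=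
  ∃ W : E → ℝ, Measurable W ∧
    ν = volume.withDensity (fun x => ENNReal.ofReal (Real.exp (-W x))) ∧
    ∀ x y, W ((1 / 2 : ℝ) • (x + y)) ≤ (W x + W y) / 2 - κ / 8 * ‖x - y‖ ^ 2

/-- Maurey's property (τ) for strongly log-concave measures. -/
theorem IsMidpointLogConcave.lintegral_mul_lintegral_le {κ : ℝ} {ν : Measure E}
    [IsProbabilityMeasure ν] (hν : IsMidpointLogConcave κ ν) {φ ψ : E → ℝ} (hφ : Measurable φ)
    (hψ : Measurable ψ) (h : ∀ x y, φ x - ψ y ≤ κ / 4 * ‖x - y‖ ^ 2) :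
    (∫⁻ x, ENNReal.ofReal (Real.exp (φ x)) ∂ν) * (∫⁻ x, ENNReal.ofReal (Real.exp (-ψ x)) ∂ν)
      ≤ 1 := by
  obtain ⟨W, hW, hνW, hmid⟩ := hν
  have h1 : ∫⁻ x, ENNReal.ofReal (Real.exp (-W x)) = 1 := by
    rw [← setLIntegral_univ, ← withDensity_apply _ MeasurableSet.univ, ← hνW, measure_univ]
  have hPL := satisfiesPrekopaLeindler_volume (E := E)
    (fun x => ENNReal.ofReal (Real.exp (-W x)) * ENNReal.ofReal (Real.exp (φ x)))
    (fun x => ENNReal.ofReal (Real.exp (-W x)) * ENNReal.ofReal (Real.exp (-ψ x)))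
    (fun x => ENNReal.ofReal (Real.exp (-W x))) (by fun_prop) (by fun_prop) (by fun_prop) (by
      intro x y
      rw [← ENNReal.ofReal_mul (by positivity), ← ENNReal.ofReal_mul (by positivity),
        ← ENNReal.ofReal_mul (by positivity), ← ENNReal.ofReal_pow (by positivity),
        ← Real.exp_add, ← Real.exp_add, ← Real.exp_add, ← Real.exp_nat_mul]
      refine ENNReal.ofReal_le_ofReal (Real.exp_le_exp.2 ?_)
      have := hmid x y
      have := h x y
      push_cast
      linarith)
  rw [h1, one_pow] at hPL
  rw [hνW, lintegral_withDensity_eq_lintegral_mul _ (by fun_prop) (by fun_prop),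
    lintegral_withDensity_eq_lintegral_mul _ (by fun_prop) (by fun_prop)]
  exact hPL

theorem IsMidpointLogConcave.integral_mul_integral_le {κ : ℝ} {ν : Measure E}
    [IsProbabilityMeasure ν] (hν : IsMidpointLogConcave κ ν) {φ ψ : E → ℝ} (hφ : Measurable φ)
    (hψ : Measurable ψ) (h : ∀ x y, φ x - ψ y ≤ κ / 4 * ‖x - y‖ ^ 2)
    (hφi : Integrable (fun x => Real.exp (φ x)) ν)
    (hψi : Integrable (fun x => Real.exp (-ψ x)) ν) :
    (∫ x, Real.exp (φ x) ∂ν) * (∫ x, Real.exp (-ψ x) ∂ν) ≤ 1 := by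
  have := hν.lintegral_mul_lintegral_le hφ hψ h
  rw [← ofReal_integral_eq_lintegral_ofReal hφi (Filter.Eventually.of_forall fun _ => by positivity),
    ← ofReal_integral_eq_lintegral_ofReal hψi (Filter.Eventually.of_forall fun _ => by positivity),
    ← ENNReal.ofReal_mul (integral_nonneg fun _ => by positivity)] at this
  simpa using this

/-- Property (τ) applies to the linear function `⟨a, ·⟩` and the same function lowered by `‖a‖² /
κ`, by Young's inequality. The other factor in the product is not zero, so this exponential moment
is finite. -/
theorem IsMidpointLogConcave.integrable_exp_inner {κ : ℝ} (hκ : 0 < κ) {ν : Measure E}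
    [IsProbabilityMeasure ν] (hν : IsMidpointLogConcave κ ν) (a : E) :
    Integrable (fun x => Real.exp (inner ℝ a x)) ν := by
  have h := hν.lintegral_mul_lintegral_le (φ := fun x => inner ℝ a x - ‖a‖ ^ 2 / κ)
    (ψ := fun x => inner ℝ a x) (by fun_prop) (by fun_prop) (by
      intro x y
      have h1 : inner ℝ a x - inner ℝ a y = inner ℝ a (x - y) := by rw [inner_sub_right]
      have h2 := real_inner_le_norm a (x - y)
      have h3 : ‖a‖ * ‖x - y‖ ≤ ‖a‖ ^ 2 / κ + κ / 4 * ‖x - y‖ ^ 2 := by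
        have h4 : ‖a‖ ^ 2 / κ + κ / 4 * ‖x - y‖ ^ 2 - ‖a‖ * ‖x - y‖
            = (‖a‖ - κ / 2 * ‖x - y‖) ^ 2 / κ := by
          field_simp
          ring
        have h5 : 0 ≤ (‖a‖ - κ / 2 * ‖x - y‖) ^ 2 / κ := by positivity
        linarith
      linarith)
  have hpos : (∫⁻ x, ENNReal.ofReal (Real.exp (-inner ℝ a x)) ∂ν) ≠ 0 := by
    rw [Ne, lintegral_eq_zero_iff (by fun_prop)]
    intro h0
    have : ∀ᵐ x ∂ν, False := by
      filter_upwards [h0] with x hx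
      have : 0 < ENNReal.ofReal (Real.exp (-inner ℝ a x)) := by positivity
      exact this.ne' hx
    exact (IsProbabilityMeasure.ne_zero ν) (by simpa using this)
  have hfin : (∫⁻ x, ENNReal.ofReal (Real.exp (inner ℝ a x - ‖a‖ ^ 2 / κ)) ∂ν) ≠ ∞ := by
    intro htop
    rw [htop, ENNReal.top_mul hpos] at h
    simp at h
  have hint : Integrable (fun x => Real.exp (inner ℝ a x - ‖a‖ ^ 2 / κ)) ν :=
    lintegral_ofReal_ne_top_iff_integrable (by fun_prop)
      (Filter.Eventually.of_forall fun _ => by positivity) |>.1 hfin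
  refine (hint.mul_const (Real.exp (‖a‖ ^ 2 / κ))).congr (Filter.Eventually.of_forall fun x => ?_)
  simp only
  rw [← Real.exp_add, sub_add_cancel]

theorem IsMidpointLogConcave.integrable_norm_sq {κ : ℝ} (hκ : 0 < κ) {ν : Measure E}
    [IsProbabilityMeasure ν] (hν : IsMidpointLogConcave κ ν) :
    Integrable (fun x => ‖x‖ ^ 2) ν := by
  set b := stdOrthonormalBasis ℝ E
  have h1 : ∀ i, Integrable (fun x => inner ℝ (b i) x ^ 2) ν := by
    intro i
    have h2 := ((hν.integrable_exp_inner hκ (b i)).add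
      (hν.integrable_exp_inner hκ (-b i))).const_mul 2
    refine h2.mono' (by fun_prop) (Filter.Eventually.of_forall fun x => ?_)
    simp only [Pi.add_apply, inner_neg_left, Real.norm_eq_abs]
    set u := inner ℝ (b i) x
    rw [abs_of_nonneg (sq_nonneg u)]
    have hp := Real.exp_pos u
    have hn := Real.exp_pos (-u)
    rcases le_total 0 u with hu | hu
    · nlinarith [Real.quadratic_le_exp_of_nonneg hu]
    · nlinarith [Real.quadratic_le_exp_of_nonneg (neg_nonneg.2 hu)]
  refine (integrable_finsetSum Finset.univ fun i _ => h1 i).congr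
    (Filter.Eventually.of_forall fun x => ?_)
  exact b.sum_sq_inner_right x

theorem Real.one_add_add_sub_le_exp {u : ℝ} (hu : |u| ≤ 1) :
    1 + u + u ^ 2 / 2 - |u| ^ 3 ≤ Real.exp u := by
  have h := Real.exp_bound hu (n := 3) (by norm_num)
  rw [abs_le] at h
  norm_num [Finset.sum_range_succ, Nat.factorial] at h
  nlinarith [pow_nonneg (abs_nonneg u) 3]

/-- Property (τ) for `φ = ε f - ε² ‖v‖² / β` and `ψ = ε f`, both exponentials being expanded to
second order. It yields `(1 + ε² A)(1 + ε² B) ≤ 1`, and the conclusion is this inequality divided by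
`ε²`. The constant `M` collects the third order errors: the cubic remainder of the exponential and
the cross term `f * q` in `φ²`. -/
theorem IsMidpointLogConcave.poincare_aux {κ : ℝ} (hκ : 0 < κ) {ν : Measure E}
    [IsProbabilityMeasure ν] (hν : IsMidpointLogConcave κ ν) {f : E → ℝ} {v : E → E} {K C : ℝ}
    (hf : Measurable f) (hv : Measurable v) (hfK : ∀ x, |f x| ≤ K) (hvK : ∀ x, ‖v x‖ ≤ K)
    (htaylor : ∀ x y, f x + inner ℝ (v x) (y - x) - C * ‖y - x‖ ^ 2 ≤ f y)
    (hf0 : ∫ x, f x ∂ν = 0)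
    {V S Q M ε : ℝ} (hV : V = ∫ x, f x ^ 2 ∂ν) (hS : S = ∫ x, ‖v x‖ ^ 2 ∂ν)
    (hQ : Q = K ^ 2 * (2 / κ)) (hM : M = (K + Q) ^ 3 + K * Q)
    (hε : 0 < ε) (hε1 : ε ≤ 1) (hβ : κ / 2 ≤ κ - 4 * ε * C) (hεL : ε * (K + Q) ≤ 1)
    (hA : 0 ≤ 1 + ε ^ 2 * (V / 2 - S / (κ - 4 * ε * C) - ε * M))
    (hB : 0 ≤ 1 + ε ^ 2 * (V / 2 - ε * M)) :
    (V / 2 - S / (κ - 4 * ε * C) - ε * M) + (V / 2 - ε * M)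
        + ε ^ 2 * ((V / 2 - S / (κ - 4 * ε * C) - ε * M) * (V / 2 - ε * M)) ≤ 0 := by
  have hK : 0 ≤ K := (abs_nonneg _).trans (hfK 0)
  have hfi : Integrable f ν := Integrable.of_bound hf.aestronglyMeasurable K
    (Filter.Eventually.of_forall hfK)
  have hf2i : Integrable (fun x => f x ^ 2) ν := by
    refine Integrable.of_bound (by fun_prop) (K ^ 2) (Filter.Eventually.of_forall fun x => ?_)
    rw [norm_pow]
    exact pow_le_pow_left₀ (norm_nonneg _) (hfK x) 2
  have hv2i : Integrable (fun x => ‖v x‖ ^ 2) ν := by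
    refine Integrable.of_bound (by fun_prop) (K ^ 2) (Filter.Eventually.of_forall fun x => ?_)
    rw [norm_pow, norm_norm]
    exact pow_le_pow_left₀ (norm_nonneg _) (hvK x) 2
  have hQ0 : 0 ≤ Q := by rw [hQ]; positivity
  -- This `β` satisfies `β / 4 + ε C = κ / 4`: the Taylor error `ε C ‖x - y‖²` and the Young term `β
  -- / 4 * ‖x - y‖²` exhaust the quadratic cost. The bound `β ≥ κ / 2` controls `q` uniformly in
  -- `ε`.
  set β := κ - 4 * ε * C with hβdef
  have hβ0 : 0 < β := by linarith
  set q : E → ℝ := fun x => ‖v x‖ ^ 2 / β with hq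
  have hqQ : ∀ x, q x ≤ Q := by
    intro x
    have h1 : ‖v x‖ ^ 2 ≤ K ^ 2 := pow_le_pow_left₀ (norm_nonneg _) (hvK x) 2
    have h2 : 1 / β ≤ 2 / κ := by
      rw [div_le_div_iff₀ hβ0 hκ]; linarith
    calc q x = ‖v x‖ ^ 2 * (1 / β) := by simp only [hq]; ring
      _ ≤ K ^ 2 * (2 / κ) := by gcongr
      _ = Q := hQ.symm
  have hq0 : ∀ x, 0 ≤ q x := fun x => by positivity
  have hφb : ∀ x, |ε * f x - ε ^ 2 * q x| ≤ ε * (K + Q) := by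
    intro x
    have h1 := abs_le.1 (hfK x)
    have h2 := hqQ x
    have h3 := hq0 x
    have h4 : ε ^ 2 * q x ≤ ε * Q := by nlinarith [mul_nonneg hε.le h3]
    have h5 : 0 ≤ ε ^ 2 * q x := by positivity
    have h6 : 0 ≤ ε * Q := by positivity
    rw [abs_le]
    constructor <;> nlinarith
  have hψb : ∀ x, |(-(ε * f x))| ≤ ε * (K + Q) := by
    intro x
    rw [abs_neg, abs_mul, abs_of_pos hε]
    have := hfK x
    gcongr
    linarith
  have hexpi : ∀ g : E → ℝ, Measurable g → (∀ x, |g x| ≤ ε * (K + Q)) →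
      Integrable (fun x => Real.exp (g x)) ν := by
    intro g hg hgb
    refine Integrable.of_bound (by fun_prop) (Real.exp (ε * (K + Q)))
      (Filter.Eventually.of_forall fun x => ?_)
    rw [Real.norm_eq_abs, Real.abs_exp]
    exact Real.exp_le_exp.2 ((le_abs_self _).trans (hgb x))
  have hφm : Measurable fun x => ε * f x - ε ^ 2 * q x := by fun_prop
  have hprod := hν.integral_mul_integral_le (φ := fun x => ε * f x - ε ^ 2 * q x)
    (ψ := fun x => ε * f x) hφm (by fun_prop) (by
      intro x y
      have h1 := htaylor x y
      have h2 : inner ℝ (v x) (y - x) = -inner ℝ (v x) (x - y) := by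
        rw [← neg_sub x y, inner_neg_right]
      rw [h2, norm_sub_rev y x] at h1
      have h3 := real_inner_le_norm (v x) (x - y)
      have h4 : ε * inner ℝ (v x) (x - y) ≤ ε ^ 2 * q x + β / 4 * ‖x - y‖ ^ 2 := by
        have h5 : ε ^ 2 * q x + β / 4 * ‖x - y‖ ^ 2 - ε * (‖v x‖ * ‖x - y‖)
            = (ε * ‖v x‖ - β / 2 * ‖x - y‖) ^ 2 / β := by
          simp only [hq]
          field_simp
          ring
        have h6 : 0 ≤ (ε * ‖v x‖ - β / 2 * ‖x - y‖) ^ 2 / β := by positivity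
        nlinarith
      simp only [hβdef] at h4
      nlinarith) (hexpi _ hφm hφb) (hexpi _ (by fun_prop) hψb)
  have hM1 : (ε * (K + Q)) ^ 3 ≤ ε ^ 3 * M := by
    rw [mul_pow, hM]
    have : 0 ≤ ε ^ 3 * (K * Q) := by positivity
    nlinarith
  have hφl : 1 + ε ^ 2 * (V / 2 - S / β - ε * M) ≤ ∫ x, Real.exp (ε * f x - ε ^ 2 * q x) ∂ν := by
    have h1 : ∫ x, (1 + ε * f x - ε ^ 2 / β * ‖v x‖ ^ 2 + ε ^ 2 / 2 * f x ^ 2 - ε ^ 3 * M) ∂ν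
        = 1 + ε ^ 2 * (V / 2 - S / β - ε * M) := by
      rw [integral_sub, integral_add, integral_sub, integral_add, integral_const_mul,
        integral_const_mul, integral_const_mul, hf0]
      · simp only [integral_const, probReal_univ, smul_eq_mul, ← hV, ← hS]
        ring
      all_goals fun_prop
    rw [← h1]
    refine integral_mono (by fun_prop) (hexpi _ hφm hφb) fun x => ?_
    have h2 := Real.one_add_add_sub_le_exp ((hφb x).trans hεL)
    have h3 : |ε * f x - ε ^ 2 * q x| ^ 3 ≤ ε ^ 3 * (K + Q) ^ 3 := by
      rw [← mul_pow]
      exact pow_le_pow_left₀ (abs_nonneg _) (hφb x) 3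
    have h4 : f x * q x ≤ K * Q :=
      mul_le_mul ((le_abs_self _).trans (hfK x)) (hqQ x) (hq0 x) hK
    have h5 : ε ^ 3 * (f x * q x) ≤ ε ^ 3 * (K * Q) := by gcongr
    have h6 : ε ^ 2 / β * ‖v x‖ ^ 2 = ε ^ 2 * q x := by
      simp only [hq]; ring
    have h7 : 0 ≤ (ε ^ 2 * q x) ^ 2 := sq_nonneg _
    have h8 : (ε * f x - ε ^ 2 * q x) ^ 2
        = ε ^ 2 * f x ^ 2 - 2 * (ε ^ 3 * (f x * q x)) + (ε ^ 2 * q x) ^ 2 := by ring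
    simp only [h6, hM]
    linarith
  have hψl : 1 + ε ^ 2 * (V / 2 - ε * M) ≤ ∫ x, Real.exp (-(ε * f x)) ∂ν := by
    have h1 : ∫ x, (1 - ε * f x + ε ^ 2 / 2 * f x ^ 2 - ε ^ 3 * M) ∂ν
        = 1 + ε ^ 2 * (V / 2 - ε * M) := by
      rw [integral_sub, integral_add, integral_sub, integral_const_mul,
        integral_const_mul, hf0]
      · simp only [integral_const, probReal_univ, smul_eq_mul, ← hV]
        ring
      all_goals fun_prop
    rw [← h1]
    refine integral_mono (by fun_prop) (hexpi _ (by fun_prop) hψb) fun x => ?_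
    have h2 := Real.one_add_add_sub_le_exp ((hψb x).trans hεL)
    have h3 : |(-(ε * f x))| ^ 3 ≤ (ε * (K + Q)) ^ 3 :=
      pow_le_pow_left₀ (abs_nonneg _) (hψb x) 3
    have h4 : (-(ε * f x)) ^ 2 = ε ^ 2 * f x ^ 2 := by ring
    simp only
    linarith
  -- The lower bounds may be multiplied because they are nonnegative, by `hA` and `hB`.
  have hAB := (mul_le_mul hφl hψl hB (hA.trans hφl)).trans hprod
  have hε2 : 0 < ε ^ 2 := by positivity
  generalize V / 2 - S / β - ε * M = a at hAB ⊢
  generalize V / 2 - ε * M = b at hAB ⊢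
  refine nonpos_of_mul_nonpos_right (a := ε ^ 2) ?_ hε2
  linarith

/-- Poincaré's inequality for strongly log-concave measures, for bounded functions with a
one-sided second order Taylor expansion. -/
theorem IsMidpointLogConcave.poincare {κ : ℝ} (hκ : 0 < κ) {ν : Measure E}
    [IsProbabilityMeasure ν] (hν : IsMidpointLogConcave κ ν) {f : E → ℝ} {v : E → E} {K C : ℝ}
    (hf : Measurable f) (hv : Measurable v) (hfK : ∀ x, |f x| ≤ K) (hvK : ∀ x, ‖v x‖ ≤ K)
    (htaylor : ∀ x y, f x + inner ℝ (v x) (y - x) - C * ‖y - x‖ ^ 2 ≤ f y)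
    (hf0 : ∫ x, f x ∂ν = 0) :
    κ * ∫ x, f x ^ 2 ∂ν ≤ ∫ x, ‖v x‖ ^ 2 ∂ν := by
  have hK : 0 ≤ K := (abs_nonneg _).trans (hfK 0)
  set V := ∫ x, f x ^ 2 ∂ν with hV
  set S := ∫ x, ‖v x‖ ^ 2 ∂ν with hS
  set Q := K ^ 2 * (2 / κ) with hQ
  set M := (K + Q) ^ 3 + K * Q with hM
  have hcont : ContinuousAt (fun ε : ℝ => S / (κ - 4 * ε * C)) 0 := by
    refine ContinuousAt.div continuousAt_const (by fun_prop) ?_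
    simpa using hκ.ne'
  -- As `ε` decreases to `0` the left side of `poincare_aux` tends to `V - S / κ`, whose
  -- nonpositivity is the claim.
  have hlim : Filter.Tendsto (fun ε : ℝ =>
      (V / 2 - S / (κ - 4 * ε * C) - ε * M) + (V / 2 - ε * M)
        + ε ^ 2 * ((V / 2 - S / (κ - 4 * ε * C) - ε * M) * (V / 2 - ε * M)))
      (nhdsWithin 0 (Set.Ioi 0)) (nhds (V - S / κ)) := by
    have : ContinuousAt (fun ε : ℝ =>
      (V / 2 - S / (κ - 4 * ε * C) - ε * M) + (V / 2 - ε * M)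
        + ε ^ 2 * ((V / 2 - S / (κ - 4 * ε * C) - ε * M) * (V / 2 - ε * M))) 0 := by fun_prop
    have h2 := this.tendsto.mono_left (nhdsWithin_le_nhds (s := Set.Ioi 0))
    convert h2 using 2
    simp
    ring
  have hev : ∀ᶠ ε : ℝ in nhdsWithin 0 (Set.Ioi 0),
      (V / 2 - S / (κ - 4 * ε * C) - ε * M) + (V / 2 - ε * M)
        + ε ^ 2 * ((V / 2 - S / (κ - 4 * ε * C) - ε * M) * (V / 2 - ε * M)) ≤ 0 := by
    have ev : ∀ g : ℝ → ℝ, ContinuousAt g 0 → 0 < g 0 →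
        ∀ᶠ ε : ℝ in nhdsWithin 0 (Set.Ioi 0), 0 ≤ g ε := fun g hg h0 =>
      nhdsWithin_le_nhds ((hg.eventually_const_lt h0).mono fun _ h => le_of_lt h)
    filter_upwards [self_mem_nhdsWithin,
      ev (fun ε => 1 - ε) (by fun_prop) (by simp),
      ev (fun ε => κ - 4 * ε * C - κ / 2) (by fun_prop) (by simp; linarith),
      ev (fun ε => 1 - ε * (K + Q)) (by fun_prop) (by simp),
      ev (fun ε => 1 + ε ^ 2 * (V / 2 - S / (κ - 4 * ε * C) - ε * M)) (by fun_prop) (by simp),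
      ev (fun ε => 1 + ε ^ 2 * (V / 2 - ε * M)) (by fun_prop) (by simp)]
      with ε h1 h2 h3 h4 h5 h6
    exact hν.poincare_aux hκ hf hv hfK hvK htaylor hf0 hV hS hQ hM h1 (by linarith) (by linarith)
      (by linarith) h5 h6
  have := le_of_tendsto hlim hev
  rw [sub_nonpos, le_div_iff₀ hκ] at this
  linarith

theorem integrable_exp_logLik {ν : Measure E} [IsFiniteMeasure ν] (r : ℝ) (y : E) :
    Integrable (fun x => Real.exp (logLik r y x)) ν := by
  refine Integrable.of_bound (by fun_prop) (Real.exp (‖y‖ ^ 2 / 2))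
    (Filter.Eventually.of_forall fun x => ?_)
  rw [Real.norm_eq_abs, Real.abs_exp]
  exact Real.exp_le_exp.2 (logLik_le r y x)

instance isProbabilityMeasure_tilted_logLik {ν : Measure E} [IsProbabilityMeasure ν] (r : ℝ)
    (y : E) : IsProbabilityMeasure (ν.tilted (logLik r y)) :=
  isProbabilityMeasure_tilted (integrable_exp_logLik r y)

/-- The potential of the posterior gains a linear term, a constant and `r² ‖x‖² / 2`; by the
parallelogram identity the last one adds exactly `r²` to the convexity constant. -/
theorem IsMidpointLogConcave.tilted_logLik {κ : ℝ} {ν : Measure E} [IsProbabilityMeasure ν]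
    (hν : IsMidpointLogConcave κ ν) (r : ℝ) (y : E) :
    IsMidpointLogConcave (κ + r ^ 2) (ν.tilted (logLik r y)) := by
  have hZ : 0 < ∫ x, Real.exp (logLik r y x) ∂ν := integral_exp_pos (integrable_exp_logLik r y)
  set Z := ∫ x, Real.exp (logLik r y x) ∂ν with hZdef
  obtain ⟨W, hW, hνW, hmid⟩ := hν
  refine ⟨fun x => W x - logLik r y x + Real.log Z, by fun_prop, ?_, fun x z => ?_⟩
  · rw [Measure.tilted, ← hZdef]
    conv_lhs => rw [hνW]
    rw [← withDensity_mul _ (by fun_prop) (by fun_prop)]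
    congr with x
    rw [Pi.mul_apply, ← ENNReal.ofReal_mul (by positivity)]
    congr 1
    rw [show -(W x - logLik r y x + Real.log Z) = -W x + (logLik r y x - Real.log Z) by ring,
      Real.exp_add, Real.exp_sub, Real.exp_log hZ]
  · have h1 := hmid x z
    have h2 : logLik r y ((1 / 2 : ℝ) • (x + z))
        = (logLik r y x + logLik r y z) / 2 + r ^ 2 / 8 * ‖x - z‖ ^ 2 := by
      have h3 := parallelogram_law_with_norm ℝ x z
      simp only [logLik, inner_smul_left, inner_add_left, norm_smul, mul_pow, Real.norm_eq_abs,
        sq_abs, conj_trivial]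
      linear_combination -(r ^ 2 / 8) * h3
    linarith

end LogConcave

/-- Along a segment, `log ρ + lam / 2 * t² ‖w‖²` has nonpositive second derivative; evaluating
concavity at the midpoint gives the claim. -/
theorem IsStronglyLogConcave.isMidpointLogConcave {n : ℕ} {lam : ℝ}
    {μ : Measure (EuclideanSpace ℝ (Fin n))} (hμ : IsStronglyLogConcave lam μ) :
    IsMidpointLogConcave lam μ := by
  obtain ⟨ρ, hρ, hμρ, hd, hdd, hlam⟩ := hμ
  set g : EuclideanSpace ℝ (Fin n) → ℝ := fun x => Real.log (ρ x) with hg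
  refine ⟨fun x => -g x, hd.continuous.measurable.neg, ?_, fun x y => ?_⟩
  · rw [hμρ]
    congr with x
    simp [hg, Real.exp_log (hρ x)]
  set w := y - x with hw
  have hline : ∀ t : ℝ, HasDerivAt (fun t : ℝ => x + t • w) w t := fun t => by
    simpa using ((hasDerivAt_id t).smul_const w).const_add x
  have h1 : ∀ t : ℝ, HasDerivAt (fun t : ℝ => g (x + t • w) + lam / 2 * t ^ 2 * ‖w‖ ^ 2)
      (fderiv ℝ g (x + t • w) w + lam * t * ‖w‖ ^ 2) t := by
    intro t
    have h2 := (hd (x + t • w)).hasFDerivAt.comp_hasDerivAt t (hline t)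
    have h3 := (((hasDerivAt_pow 2 t).const_mul (lam / 2)).mul_const (‖w‖ ^ 2))
    refine (h2.add h3).congr_deriv ?_
    push_cast
    ring
  have h2 : ∀ t : ℝ, HasDerivAt (fun t : ℝ => fderiv ℝ g (x + t • w) w + lam * t * ‖w‖ ^ 2)
      (fderiv ℝ (fderiv ℝ g) (x + t • w) w w + lam * ‖w‖ ^ 2) t := by
    intro t
    have h2 := (hdd (x + t • w)).hasFDerivAt.comp_hasDerivAt t (hline t)
    have h3 := h2.clm_apply (hasDerivAt_const t w)
    have h4 := ((hasDerivAt_id t).const_mul lam).mul_const (‖w‖ ^ 2)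
    refine (h3.add h4).congr_deriv ?_
    simp
  have hconc := concaveOn_of_hasDerivWithinAt2_nonpos (convex_univ (𝕜 := ℝ) (E := ℝ))
    (fun t _ => (h1 t).continuousAt.continuousWithinAt) (fun t _ => (h1 t).hasDerivWithinAt)
    (fun t _ => (h2 t).hasDerivWithinAt) (fun t _ => by linarith [hlam (x + t • w) w])
  have h3 := hconc.2 (Set.mem_univ (0 : ℝ)) (Set.mem_univ (1 : ℝ))
    (show (0 : ℝ) ≤ 1 / 2 by norm_num) (show (0 : ℝ) ≤ 1 / 2 by norm_num) (by norm_num)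
  have h4 : x + (1 / 2 : ℝ) • w = (1 / 2 : ℝ) • (x + y) := by
    rw [hw]
    module
  have h5 : x + (1 : ℝ) • w = y := by
    rw [hw]
    module
  simp only [smul_eq_mul, mul_zero, mul_one, zero_add, zero_smul, add_zero, h4, h5] at h3
  rw [norm_sub_rev x y]
  nlinarith

/-! ### Gaussian averages: Taylor expansion in the shift and variance bound. -/

section GaussianSmoothing

variable {E : Type*} [NormedAddCommGroup E] [InnerProductSpace ℝ E] [FiniteDimensional ℝ E]
  [MeasurableSpace E] [BorelSpace E]

theorem map_add_stdGaussian (a : E) :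
    (stdGaussian E).map (fun z => a + z) = (stdGaussian E).withDensity
      (fun z => ENNReal.ofReal (Real.exp (inner ℝ a z - ‖a‖ ^ 2 / 2))) := by
  refine Measure.ext_of_lintegral _ fun g hg => ?_
  rw [lintegral_map hg (by fun_prop), lintegral_stdGaussian_add,
    lintegral_withDensity_eq_lintegral_mul _ (by fun_prop) hg]
  rfl

theorem integral_stdGaussian_add (a : E) {g : E → ℝ} (hg : Measurable g) :
    ∫ z, g (a + z) ∂(stdGaussian E)
      = ∫ z, Real.exp (inner ℝ a z - ‖a‖ ^ 2 / 2) * g z ∂(stdGaussian E) := by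
  rw [← integral_map (φ := fun z => a + z) (by fun_prop) hg.aestronglyMeasurable,
    map_add_stdGaussian, integral_withDensity_eq_integral_toReal_smul (by fun_prop) (by simp)]
  refine integral_congr_ae (Filter.Eventually.of_forall fun z => ?_)
  simp [ENNReal.toReal_ofReal (Real.exp_nonneg _)]

theorem integrable_stdGaussian_add (a : E) {g : E → ℝ} (hg : Measurable g) :
    Integrable (fun z => Real.exp (inner ℝ a z - ‖a‖ ^ 2 / 2) * g z) (stdGaussian E)
      ↔ Integrable (fun z => g (a + z)) (stdGaussian E) := by
  have h1 : Integrable g ((stdGaussian E).map (fun z => a + z)) ↔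
      Integrable (fun z => g (a + z)) (stdGaussian E) :=
    integrable_map_measure hg.aestronglyMeasurable (by fun_prop)
  rw [← h1, map_add_stdGaussian, integrable_withDensity_iff_integrable_smul' (by fun_prop)
    (by simp)]
  refine integrable_congr (Filter.Eventually.of_forall fun z => ?_)
  simp [ENNReal.toReal_ofReal (Real.exp_nonneg _)]

theorem memLp_inner_stdGaussian (a : E) : MemLp (fun z => inner ℝ a z) 2 (stdGaussian E) :=
  IsGaussian.memLp_dual (stdGaussian E) (innerSL ℝ a) 2 (by simp)

theorem integrable_inner_stdGaussian (a : E) :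
    Integrable (fun z => inner ℝ a z) (stdGaussian E) :=
  (memLp_inner_stdGaussian a).integrable (by norm_num)

theorem integral_inner_stdGaussian (a : E) : ∫ z, inner ℝ a z ∂(stdGaussian E) = 0 :=
  integral_strongDual_stdGaussian (innerSL ℝ a)

theorem integral_inner_sq_stdGaussian (a : E) :
    ∫ z, inner ℝ a z ^ 2 ∂(stdGaussian E) = ‖a‖ ^ 2 := by
  have h := variance_dual_stdGaussian (innerSL ℝ a)
  rw [variance_of_integral_eq_zero (by fun_prop) (integral_strongDual_stdGaussian _),
    innerSL_apply_norm] at h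
  exact h

theorem integrable_exp_inner_stdGaussian (a : E) :
    Integrable (fun z => Real.exp (inner ℝ a z - ‖a‖ ^ 2 / 2)) (stdGaussian E) := by
  have := (integrable_stdGaussian_add a (g := fun _ => 1) measurable_const).2 (integrable_const _)
  simpa using this

theorem integral_exp_inner_stdGaussian (a : E) :
    ∫ z, Real.exp (inner ℝ a z - ‖a‖ ^ 2 / 2) ∂(stdGaussian E) = 1 := by
  have := integral_stdGaussian_add a (g := fun _ => 1) measurable_const
  simpa using this.symm

theorem exp_inner_add (a z : E) : Real.exp (inner ℝ a (a + z) - ‖a‖ ^ 2 / 2)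
    = Real.exp (‖a‖ ^ 2) * Real.exp (inner ℝ a z - ‖a‖ ^ 2 / 2) := by
  rw [inner_add_right, real_inner_self_eq_norm_sq, ← Real.exp_add]
  ring_nf

theorem memLp_exp_inner_stdGaussian (a : E) :
    MemLp (fun z => Real.exp (inner ℝ a z - ‖a‖ ^ 2 / 2)) 2 (stdGaussian E) := by
  rw [memLp_two_iff_integrable_sq (by fun_prop)]
  simp_rw [pow_two (Real.exp _)]
  rw [integrable_stdGaussian_add a (by fun_prop)]
  simp_rw [exp_inner_add]
  exact (integrable_exp_inner_stdGaussian a).const_mul _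

/-- The squared `L²` error of linearising the Cameron-Martin density in the shift. It is of order
`‖a‖⁴`, so a bounded function has a Gaussian average with quadratic Taylor error. -/
theorem integral_sq_exp_inner_sub_stdGaussian (a : E) :
    ∫ z, (Real.exp (inner ℝ a z - ‖a‖ ^ 2 / 2) - 1 - inner ℝ a z) ^ 2 ∂(stdGaussian E)
      = Real.exp (‖a‖ ^ 2) - 1 - ‖a‖ ^ 2 := by
  have hL := memLp_exp_inner_stdGaussian a
  have hL1 := integrable_exp_inner_stdGaussian a
  have hz := memLp_inner_stdGaussian a
  have hz1 := integrable_inner_stdGaussian a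
  have hLz : Integrable (fun z => Real.exp (inner ℝ a z - ‖a‖ ^ 2 / 2) * inner ℝ a z)
      (stdGaussian E) := hL.integrable_mul hz
  have hL2 : Integrable (fun z => Real.exp (inner ℝ a z - ‖a‖ ^ 2 / 2) *
      Real.exp (inner ℝ a z - ‖a‖ ^ 2 / 2)) (stdGaussian E) := hL.integrable_mul hL
  have hz2 := hz.integrable_sq
  have e1 : ∫ z, Real.exp (inner ℝ a z - ‖a‖ ^ 2 / 2) * inner ℝ a z ∂(stdGaussian E) = ‖a‖ ^ 2 := by
    rw [← integral_stdGaussian_add a (by fun_prop)]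
    simp_rw [inner_add_right, real_inner_self_eq_norm_sq]
    rw [integral_add (integrable_const _) hz1, integral_inner_stdGaussian]
    simp
  have e2 : ∫ z, Real.exp (inner ℝ a z - ‖a‖ ^ 2 / 2) * Real.exp (inner ℝ a z - ‖a‖ ^ 2 / 2)
      ∂(stdGaussian E) = Real.exp (‖a‖ ^ 2) := by
    rw [← integral_stdGaussian_add a (by fun_prop)]
    simp_rw [exp_inner_add]
    rw [integral_const_mul, integral_exp_inner_stdGaussian, mul_one]
  have e3 : ∀ z, (Real.exp (inner ℝ a z - ‖a‖ ^ 2 / 2) - 1 - inner ℝ a z) ^ 2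
      = Real.exp (inner ℝ a z - ‖a‖ ^ 2 / 2) * Real.exp (inner ℝ a z - ‖a‖ ^ 2 / 2)
        - 2 * (Real.exp (inner ℝ a z - ‖a‖ ^ 2 / 2) * inner ℝ a z)
        - 2 * Real.exp (inner ℝ a z - ‖a‖ ^ 2 / 2) + inner ℝ a z ^ 2 + 2 * inner ℝ a z + 1 := by
    intro z
    ring
  simp_rw [e3]
  rw [integral_add, integral_add, integral_add, integral_sub, integral_sub, integral_const_mul,
    integral_const_mul, integral_const_mul, e1, e2, integral_exp_inner_stdGaussian,
    integral_inner_stdGaussian, integral_inner_sq_stdGaussian]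
  · simp
    ring
  all_goals fun_prop

theorem integrable_bounded_mul_inner_stdGaussian {g : E → ℝ} (hg : Measurable g) {K : ℝ}
    (hgK : ∀ x, |g x| ≤ K) (a : E) :
    Integrable (fun z => g z * inner ℝ a z) (stdGaussian E) :=
  (integrable_inner_stdGaussian a).bdd_mul hg.aestronglyMeasurable
    (Filter.Eventually.of_forall hgK)

theorem integrable_bounded_smul_stdGaussian {g : E → ℝ} (hg : Measurable g) {K : ℝ}
    (hgK : ∀ x, |g x| ≤ K) :
    Integrable (fun z => g z • z) (stdGaussian E) :=
  (IsGaussian.integrable_id (μ := stdGaussian E)).bdd_smul _ hg.aestronglyMeasurable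
    (Filter.Eventually.of_forall hgK)

theorem integrable_of_bounded {Ω : Type*} [MeasurableSpace Ω] {ν : Measure Ω} [IsFiniteMeasure ν]
    {g : Ω → ℝ} (hg : Measurable g) {K : ℝ} (hgK : ∀ x, |g x| ≤ K) : Integrable g ν :=
  Integrable.of_bound hg.aestronglyMeasurable K (Filter.Eventually.of_forall hgK)

theorem abs_sq_le_of_abs_le {a K : ℝ} (h : |a| ≤ K) : |a ^ 2| ≤ K ^ 2 := by
  rw [abs_pow]
  exact pow_le_pow_left₀ (abs_nonneg _) h 2

/-- Bessel's inequality for the linear part of a function under the standard Gaussian. -/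
theorem norm_sq_integral_smul_stdGaussian_le {g : E → ℝ} (hg : Measurable g) {K : ℝ}
    (hgK : ∀ x, |g x| ≤ K) :
    ‖∫ z, g z • z ∂(stdGaussian E)‖ ^ 2
      ≤ ∫ z, g z ^ 2 ∂(stdGaussian E) - (∫ z, g z ∂(stdGaussian E)) ^ 2 := by
  set V := ∫ z, g z • z ∂(stdGaussian E) with hV
  set m := ∫ z, g z ∂(stdGaussian E) with hm
  have hgi : Integrable g (stdGaussian E) := integrable_of_bounded hg hgK
  have hg2 : Integrable (fun z => g z ^ 2) (stdGaussian E) :=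
    integrable_of_bounded (hg.pow_const 2) fun x => abs_sq_le_of_abs_le (hgK x)
  have hgz := integrable_bounded_mul_inner_stdGaussian hg hgK V
  have hz2 := (memLp_inner_stdGaussian V).integrable_sq
  have hz1 := integrable_inner_stdGaussian V
  have e1 : ∫ z, g z * inner ℝ V z ∂(stdGaussian E) = ‖V‖ ^ 2 := by
    rw [← real_inner_self_eq_norm_sq]
    conv_rhs => rw [hV]
    rw [real_inner_comm, ← hV, hV, ← integral_inner (integrable_bounded_smul_stdGaussian hg hgK)]
    simp [inner_smul_right, ← hV]
  -- Subtract from `g` its projection on the affine functions; the remainder has nonnegative squared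
  -- norm.
  have h0 : 0 ≤ ∫ z, (g z - m - inner ℝ V z) ^ 2 ∂(stdGaussian E) :=
    integral_nonneg fun z => sq_nonneg _
  have e3 : ∀ z, (g z - m - inner ℝ V z) ^ 2 = g z ^ 2 - 2 * m * g z - 2 * (g z * inner ℝ V z)
      + inner ℝ V z ^ 2 + 2 * m * inner ℝ V z + m ^ 2 := by
    intro z
    ring
  simp_rw [e3] at h0
  rw [integral_add, integral_add, integral_add, integral_sub, integral_sub, integral_const_mul,
    integral_const_mul, integral_const_mul, e1, ← hm, integral_inner_stdGaussian,
    integral_inner_sq_stdGaussian] at h0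
  · simp at h0
    linarith
  all_goals fun_prop

theorem abs_integral_le_of_abs_le {Ω : Type*} [MeasurableSpace Ω] {ν : Measure Ω}
    [IsProbabilityMeasure ν] {g : Ω → ℝ} {K : ℝ} (hgK : ∀ x, |g x| ≤ K) : |∫ x, g x ∂ν| ≤ K := by
  have := norm_integral_le_of_norm_le_const (μ := ν) (f := g) (C := K)
    (Filter.Eventually.of_forall hgK)
  simpa using this

theorem sq_integral_le {Ω : Type*} [MeasurableSpace Ω] {ν : Measure Ω} [IsProbabilityMeasure ν]
    {g : Ω → ℝ} (hg : MemLp g 2 ν) : (∫ x, g x ∂ν) ^ 2 ≤ ∫ x, g x ^ 2 ∂ν := by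
  have h := variance_nonneg g ν
  rw [variance_eq_sub hg] at h
  simpa using h

/-- Taylor expansion of a Gaussian average under a shift. -/
theorem abs_integral_add_sub_stdGaussian_le {g : E → ℝ} (hg : Measurable g) {K : ℝ}
    (hgK : ∀ x, |g x| ≤ K) (a : E) :
    |∫ z, g (a + z) ∂(stdGaussian E) - ∫ z, g z ∂(stdGaussian E)
      - inner ℝ (∫ z, g z • z ∂(stdGaussian E)) a| ≤ 3 * K * ‖a‖ ^ 2 := by
  have hK : 0 ≤ K := (abs_nonneg _).trans (hgK 0)
  have hgi : Integrable g (stdGaussian E) := integrable_of_bounded hg hgK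
  have hgz := integrable_bounded_mul_inner_stdGaussian hg hgK a
  have e1 : inner ℝ (∫ z, g z • z ∂(stdGaussian E)) a = ∫ z, g z * inner ℝ a z ∂(stdGaussian E) := by
    rw [real_inner_comm, ← integral_inner (integrable_bounded_smul_stdGaussian hg hgK)]
    simp [inner_smul_right]
  -- Short shifts use the `L²` error of the linearised density. For long ones the three terms are
  -- bounded separately by `K`, `K` and `K ‖a‖`, whence the constant `3`.
  rcases le_or_gt ‖a‖ 1 with ha | ha
  · have hL1 := integrable_exp_inner_stdGaussian a
    have hz1 := integrable_inner_stdGaussian a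
    have hgL : Integrable (fun z => Real.exp (inner ℝ a z - ‖a‖ ^ 2 / 2) * g z) (stdGaussian E) :=
      (integrable_stdGaussian_add a hg).2
        (integrable_of_bounded (by fun_prop) fun z => hgK (a + z))
    rw [integral_stdGaussian_add a hg, e1, ← integral_sub hgL hgi, ← integral_sub (hgL.sub' hgi) hgz]
    have hmem : MemLp (fun z => |Real.exp (inner ℝ a z - ‖a‖ ^ 2 / 2) - 1 - inner ℝ a z|) 2
        (stdGaussian E) :=
      (((memLp_exp_inner_stdGaussian a).sub (memLp_const 1)).sub (memLp_inner_stdGaussian a)).abs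
    have h1 := sq_integral_le hmem
    simp_rw [sq_abs] at h1
    rw [integral_sq_exp_inner_sub_stdGaussian] at h1
    have h2 : Real.exp (‖a‖ ^ 2) - 1 - ‖a‖ ^ 2 ≤ (‖a‖ ^ 2) ^ 2 := by
      have := Real.abs_exp_sub_one_sub_id_le (x := ‖a‖ ^ 2)
        (by rw [abs_of_nonneg (sq_nonneg _)]; exact pow_le_one₀ (norm_nonneg _) ha)
      exact (le_abs_self _).trans this
    have h3 := abs_le.1 (abs_le_of_sq_le_sq (h1.trans h2) (sq_nonneg _))
    have h4 : |∫ z, (Real.exp (inner ℝ a z - ‖a‖ ^ 2 / 2) * g z - g z - g z * inner ℝ a z)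
        ∂(stdGaussian E)| ≤ ∫ z, K * |Real.exp (inner ℝ a z - ‖a‖ ^ 2 / 2) - 1 - inner ℝ a z|
        ∂(stdGaussian E) := by
      rw [← Real.norm_eq_abs]
      refine norm_integral_le_of_norm_le ((hmem.integrable (by norm_num)).const_mul K)
        (Filter.Eventually.of_forall fun z => ?_)
      rw [show Real.exp (inner ℝ a z - ‖a‖ ^ 2 / 2) * g z - g z - g z * inner ℝ a z
        = g z * (Real.exp (inner ℝ a z - ‖a‖ ^ 2 / 2) - 1 - inner ℝ a z) by ring, norm_mul]
      exact mul_le_mul_of_nonneg_right (hgK z) (norm_nonneg _)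
    rw [integral_const_mul] at h4
    have h5 := mul_le_mul_of_nonneg_left h3.2 hK
    have h6 : 0 ≤ K * ‖a‖ ^ 2 := by positivity
    linarith
  · have h1 := abs_integral_le_of_abs_le (ν := stdGaussian E) fun z => hgK (a + z)
    have h2 := abs_integral_le_of_abs_le (ν := stdGaussian E) hgK
    have h3 : |inner ℝ (∫ z, g z • z ∂(stdGaussian E)) a| ≤ K * ‖a‖ := by
      refine (abs_real_inner_le_norm _ _).trans ?_
      gcongr
      refine (le_abs_self _).trans (abs_le_of_sq_le_sq (?_ : _ ≤ K ^ 2) hK)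
      refine (norm_sq_integral_smul_stdGaussian_le hg hgK).trans ?_
      have := abs_integral_le_of_abs_le (ν := stdGaussian E) fun z => abs_sq_le_of_abs_le (hgK z)
      have := (le_abs_self _).trans this
      linarith [sq_nonneg (∫ z, g z ∂(stdGaussian E))]
    rw [abs_le] at h1 h2 h3 ⊢
    have h4 : K ≤ K * ‖a‖ ^ 2 := le_mul_of_one_le_right hK (one_le_pow₀ ha.le)
    have h5 : K * ‖a‖ ≤ K * ‖a‖ ^ 2 := by
      gcongr
      exact le_self_pow₀ ha.le (by norm_num)
    constructor <;> linarith

/-- The variance of a Gaussian average `x ↦ 𝔼 g(h x + Z)` under a strongly log-concave measure is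
controlled by the mean conditional variance of `g(h X + Z)`. -/
theorem IsMidpointLogConcave.variance_integral_stdGaussian_le {κ : ℝ} (hκ : 0 < κ) {ν : Measure E}
    [IsProbabilityMeasure ν] (hν : IsMidpointLogConcave κ ν) {g : E → ℝ} (hg : Measurable g)
    {K : ℝ} (hgK : ∀ x, |g x| ≤ K) (h : ℝ) :
    κ * (∫ x, (∫ z, g (h • x + z) ∂(stdGaussian E)) ^ 2 ∂ν
        - (∫ x, ∫ z, g (h • x + z) ∂(stdGaussian E) ∂ν) ^ 2)
      ≤ h ^ 2 * (∫ x, ∫ z, g (h • x + z) ^ 2 ∂(stdGaussian E) ∂ν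
        - ∫ x, (∫ z, g (h • x + z) ∂(stdGaussian E)) ^ 2 ∂ν) := by
  have hK : 0 ≤ K := (abs_nonneg _).trans (hgK 0)
  set f : E → ℝ := fun x => ∫ z, g (h • x + z) ∂(stdGaussian E) with hf
  set f2 : E → ℝ := fun x => ∫ z, g (h • x + z) ^ 2 ∂(stdGaussian E) with hf2
  set v : E → E := fun x => h • ∫ z, g (h • x + z) • z ∂(stdGaussian E) with hv
  have hfm : Measurable f :=
    (StronglyMeasurable.integral_prod_right (f := fun x z => g (h • x + z))
      (Measurable.stronglyMeasurable (by fun_prop))).measurable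
  have hf2m : Measurable f2 :=
    (StronglyMeasurable.integral_prod_right (f := fun x z => g (h • x + z) ^ 2)
      (Measurable.stronglyMeasurable (by fun_prop))).measurable
  have hvm : Measurable v :=
    (StronglyMeasurable.integral_prod_right (f := fun x z => g (h • x + z) • z)
      (Measurable.stronglyMeasurable (by fun_prop))).measurable.const_smul h
  have hfK : ∀ x, |f x| ≤ K := fun x => abs_integral_le_of_abs_le fun z => hgK _
  have hf2K : ∀ x, |f2 x| ≤ K ^ 2 := fun x =>
    abs_integral_le_of_abs_le fun z => abs_sq_le_of_abs_le (hgK _)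
  -- Here `v` plays the role of the gradient of `f`, by Gaussian integration by parts; Bessel turns
  -- it into a conditional variance.
  have hv2 : ∀ x, ‖v x‖ ^ 2 ≤ h ^ 2 * (f2 x - f x ^ 2) := by
    intro x
    rw [hv, norm_smul, mul_pow, Real.norm_eq_abs, sq_abs]
    exact mul_le_mul_of_nonneg_left
      (norm_sq_integral_smul_stdGaussian_le (g := fun z => g (h • x + z)) (by fun_prop)
        fun z => hgK _) (sq_nonneg _)
  have hvK : ∀ x, ‖v x‖ ≤ |h| * K := by
    intro x
    refine (le_abs_self _).trans (abs_le_of_sq_le_sq (?_ : _ ≤ (|h| * K) ^ 2) (by positivity))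
    rw [mul_pow, sq_abs]
    refine (hv2 x).trans (mul_le_mul_of_nonneg_left ?_ (sq_nonneg _))
    have := (le_abs_self _).trans (hf2K x)
    linarith [sq_nonneg (f x)]
  set c := ∫ x, f x ∂ν with hc
  have hcK : |c| ≤ K := abs_integral_le_of_abs_le hfK
  have hfi : Integrable f ν := integrable_of_bounded hfm hfK
  have hfsq : Integrable (fun x => f x ^ 2) ν :=
    integrable_of_bounded (by fun_prop) fun x => abs_sq_le_of_abs_le (hfK x)
  have hf2i : Integrable f2 ν := integrable_of_bounded hf2m hf2K
  have hP := hν.poincare hκ (f := fun x => f x - c) (v := v) (K := 2 * K + |h| * K)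
    (C := 3 * K * h ^ 2) (by fun_prop) hvm (fun x => by
      have h1 := abs_sub (f x) c
      have h2 : 0 ≤ |h| * K := by positivity
      linarith [hfK x]) (fun x => by linarith [hvK x]) (fun x y => by
      have h1 := abs_integral_add_sub_stdGaussian_le (g := fun z => g (h • x + z)) (by fun_prop)
        (fun z => hgK _) (h • (y - x))
      have h2 : ∀ z, h • x + (h • (y - x) + z) = h • y + z := fun z => by module
      simp only [h2, inner_smul_right, norm_smul, mul_pow, Real.norm_eq_abs, sq_abs] at h1
      have h3 := (abs_le.1 h1).1
      simp only [hv, inner_smul_left, conj_trivial]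
      simp only [hf]
      linarith) (by
      rw [integral_sub hfi (integrable_const _)]
      simp [hc])
  have e1 : ∫ x, (f x - c) ^ 2 ∂ν = ∫ x, f x ^ 2 ∂ν - c ^ 2 := by
    have e2 : ∀ x, (f x - c) ^ 2 = f x ^ 2 - 2 * c * f x + c ^ 2 := fun x => by ring
    simp_rw [e2]
    rw [integral_add, integral_sub, integral_const_mul, ← hc]
    · simp
      ring
    all_goals fun_prop
  rw [e1] at hP
  refine hP.trans ?_
  rw [← integral_sub hf2i hfsq, ← integral_const_mul]
  refine integral_mono ?_ ((hf2i.sub hfsq).const_mul _) hv2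
  exact integrable_of_bounded (by fun_prop) (K := (|h| * K) ^ 2) fun x =>
    abs_sq_le_of_abs_le (by simpa using hvK x)

end GaussianSmoothing

/-! ### Posterior means and the contraction of their variance. -/

section Channel

variable {E : Type*} [NormedAddCommGroup E] [InnerProductSpace ℝ E] [FiniteDimensional ℝ E]
  [MeasurableSpace E] [BorelSpace E]

/-- The density, with respect to the standard Gaussian, of the law of the observation. -/
noncomputable def evidence (ν : Measure E) (r : ℝ) (y : E) : ℝ := ∫ x, Real.exp (logLik r y x) ∂ν

/-- The posterior mean of `q` given the observation `y`. -/
noncomputable def postAvg {F : Type*} [NormedAddCommGroup F] [NormedSpace ℝ F] (ν : Measure E)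
    (r : ℝ) (q : E → F) (y : E) : F := ∫ x, q x ∂(ν.tilted (logLik r y))

variable {F : Type*} [NormedAddCommGroup F] [NormedSpace ℝ F] {ν : Measure E}
  [IsProbabilityMeasure ν] {r : ℝ}

theorem evidence_pos (ν : Measure E) [IsProbabilityMeasure ν] (r : ℝ) (y : E) :
    0 < evidence ν r y :=
  integral_exp_pos (integrable_exp_logLik r y)

@[fun_prop]
theorem measurable_evidence : Measurable (evidence ν r) :=
  (StronglyMeasurable.integral_prod_right (f := fun y x => Real.exp (logLik r y x))
    (Measurable.stronglyMeasurable (by unfold logLik; fun_prop))).measurable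

theorem evidence_le (y : E) : evidence ν r y ≤ Real.exp (‖y‖ ^ 2 / 2) := by
  have := integral_mono (integrable_exp_logLik (ν := ν) r y) (integrable_const _)
    fun x => Real.exp_le_exp.2 (logLik_le r y x)
  simpa [evidence] using this

theorem integrable_exp_logLik_smul {q : E → F} (hq : Integrable q ν) (y : E) :
    Integrable (fun x => Real.exp (logLik r y x) • q x) ν := by
  refine hq.bdd_smul (Real.exp (‖y‖ ^ 2 / 2))
    (by fun_prop) (Filter.Eventually.of_forall fun x => ?_)
  rw [Real.norm_eq_abs, Real.abs_exp]
  exact Real.exp_le_exp.2 (logLik_le r y x)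

theorem MeasureTheory.Integrable.tilted_logLik {q : E → F} (hq : Integrable q ν) (r : ℝ) (y : E) :
    Integrable q (ν.tilted (logLik r y)) := by
  rw [integrable_tilted_iff (integrable_exp_logLik r y)]
  exact integrable_exp_logLik_smul hq y

theorem postAvg_eq (q : E → F) (y : E) :
    postAvg ν r q y = (evidence ν r y)⁻¹ • ∫ x, Real.exp (logLik r y x) • q x ∂ν := by
  rw [postAvg, integral_tilted, ← integral_smul]
  congr with x
  rw [smul_smul, div_eq_inv_mul, evidence]

theorem stronglyMeasurable_postAvg {q : E → F} (hq : StronglyMeasurable q) :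
    StronglyMeasurable (postAvg ν r q) := by
  have h : postAvg ν r q = fun y => (evidence ν r y)⁻¹ • ∫ x, Real.exp (logLik r y x) • q x ∂ν :=
    funext fun y => postAvg_eq q y
  rw [h]
  refine measurable_evidence.inv.stronglyMeasurable.smul ?_
  refine StronglyMeasurable.integral_prod_right (f := fun y x => Real.exp (logLik r y x) • q x) ?_
  refine StronglyMeasurable.smul (Measurable.stronglyMeasurable ?_) (hq.comp_measurable measurable_snd)
  unfold logLik
  fun_prop

theorem integral_channelLaw (G : E × E → ℝ) :
    ∫ p, G p ∂(channelLaw ν r)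
      = ∫ p, Real.exp (logLik r p.2 p.1) * G p ∂(ν.prod (stdGaussian E)) := by
  rw [channelLaw_eq_withDensity, integral_withDensity_eq_integral_toReal_smul (by fun_prop)
    (by simp)]
  refine integral_congr_ae (Filter.Eventually.of_forall fun z => ?_)
  simp [ENNReal.toReal_ofReal (Real.exp_nonneg _)]

theorem integrable_channelLaw_iff (G : E × E → ℝ) : Integrable G (channelLaw ν r)
    ↔ Integrable (fun p => Real.exp (logLik r p.2 p.1) * G p) (ν.prod (stdGaussian E)) := by
  rw [channelLaw_eq_withDensity, integrable_withDensity_iff_integrable_smul' (by fun_prop)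
    (by simp)]
  refine integrable_congr (Filter.Eventually.of_forall fun z => ?_)
  simp [ENNReal.toReal_ofReal (Real.exp_nonneg _)]

theorem evidence_mul_postAvg (q : E → ℝ) (y : E) :
    evidence ν r y * postAvg ν r q y = ∫ x, Real.exp (logLik r y x) * q x ∂ν := by
  rw [postAvg_eq, smul_eq_mul, mul_inv_cancel_left₀ (evidence_pos ν r y).ne']
  rfl

/-- Bayes' formula. -/
theorem integral_channelLaw_eq_postAvg {G : E × E → ℝ} (hG : Integrable G (channelLaw ν r)) :
    ∫ p, G p ∂(channelLaw ν r)
      = ∫ y, evidence ν r y * postAvg ν r (fun x => G (x, y)) y ∂(stdGaussian E) := by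
  rw [integral_channelLaw, integral_prod_symm _ ((integrable_channelLaw_iff G).1 hG)]
  simp_rw [evidence_mul_postAvg]

theorem integrable_evidence_mul_postAvg {G : E × E → ℝ} (hG : Integrable G (channelLaw ν r)) :
    Integrable (fun y => evidence ν r y * postAvg ν r (fun x => G (x, y)) y) (stdGaussian E) := by
  simp_rw [evidence_mul_postAvg]
  exact ((integrable_channelLaw_iff G).1 hG).integral_prod_right

theorem integrable_comp_snd_channelLaw_iff {g : E → ℝ} (hg : Measurable g) :
    Integrable (fun p => g p.2) (channelLaw ν r)
      ↔ Integrable (fun y => evidence ν r y * g y) (stdGaussian E) := by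
  rw [integrable_channelLaw_iff]
  constructor
  · intro h
    refine h.integral_prod_right.congr (Filter.Eventually.of_forall fun y => ?_)
    simp only
    rw [integral_mul_const, evidence]
  · intro h
    rw [integrable_prod_iff' (by fun_prop)]
    refine ⟨Filter.Eventually.of_forall fun y => (integrable_exp_logLik r y).mul_const (g y), ?_⟩
    refine h.norm.congr (Filter.Eventually.of_forall fun y => ?_)
    simp only [norm_mul, Real.norm_eq_abs, Real.abs_exp, abs_of_pos (evidence_pos ν r y)]
    rw [integral_mul_const, evidence]

theorem integral_comp_snd_channelLaw {g : E → ℝ}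
    (hgi : Integrable (fun p => g p.2) (channelLaw ν r)) :
    ∫ p, g p.2 ∂(channelLaw ν r) = ∫ y, evidence ν r y * g y ∂(stdGaussian E) := by
  rw [integral_channelLaw_eq_postAvg hgi]
  simp [postAvg]

theorem integrable_comp_fst_channelLaw {q : E → ℝ} (hq : Integrable q ν) :
    Integrable (fun p => q p.1) (channelLaw ν r) := by
  rw [channelLaw]
  have h : (fun p : E × E => q p.1) ∘ (fun p : E × E => (p.1, r • p.1 + p.2))
    = fun p => q p.1 := rfl
  have h1 : Integrable (fun p : E × E => q p.1) (ν.prod (stdGaussian E)) := hq.comp_fst _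
  refine (integrable_map_measure ?_ (by fun_prop)).2 (h ▸ h1)
  have h2 : ((ν.prod (stdGaussian E)).map (fun p : E × E => (p.1, r • p.1 + p.2))).map Prod.fst
      = ν := by
    rw [Measure.map_map (by fun_prop) (by fun_prop)]
    exact measurePreserving_fst.map_eq
  have h3 : AEStronglyMeasurable q
      (((ν.prod (stdGaussian E)).map (fun p : E × E => (p.1, r • p.1 + p.2))).map Prod.fst) := by
    rw [h2]
    exact hq.aestronglyMeasurable
  exact h3.comp_measurable measurable_fst

theorem integral_channelLaw_eq_integral_integral {G : E × E → ℝ}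
    (hG : Integrable G (channelLaw ν r)) :
    ∫ p, G p ∂(channelLaw ν r) = ∫ x, ∫ z, G (x, r • x + z) ∂(stdGaussian E) ∂ν := by
  rw [channelLaw] at hG ⊢
  rw [integral_map (by fun_prop) hG.aestronglyMeasurable]
  exact integral_prod _ ((integrable_map_measure hG.aestronglyMeasurable (by fun_prop)).1 hG)

theorem integral_comp_fst_channelLaw {q : E → ℝ} (hq : Integrable q ν) :
    ∫ p, q p.1 ∂(channelLaw ν r) = ∫ x, q x ∂ν := by
  rw [integral_channelLaw_eq_integral_integral (integrable_comp_fst_channelLaw hq)]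
  simp

theorem integrable_postAvg {q : E → ℝ} (hq : Integrable q ν) (hqm : Measurable q) :
    Integrable (fun p => postAvg ν r q p.2) (channelLaw ν r) :=
  (integrable_comp_snd_channelLaw_iff (stronglyMeasurable_postAvg hqm.stronglyMeasurable).measurable).2
    (integrable_evidence_mul_postAvg (integrable_comp_fst_channelLaw hq))

theorem integral_postAvg {q : E → ℝ} (hq : Integrable q ν) (hqm : Measurable q) :
    ∫ p, postAvg ν r q p.2 ∂(channelLaw ν r) = ∫ x, q x ∂ν := by
  rw [integral_comp_snd_channelLaw (integrable_postAvg hq hqm),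
    ← integral_comp_fst_channelLaw (r := r) hq,
    integral_channelLaw_eq_postAvg (integrable_comp_fst_channelLaw hq)]

theorem integrable_sq_tilted_logLik {q : E → ℝ} (hqm : Measurable q)
    (hq : Integrable (fun x => q x ^ 2) ν) (y : E) : MemLp q 2 (ν.tilted (logLik r y)) :=
  (memLp_two_iff_integrable_sq hqm.aestronglyMeasurable).2 (hq.tilted_logLik r y)

theorem sq_postAvg_le {q : E → ℝ} (hqm : Measurable q) (hq : Integrable (fun x => q x ^ 2) ν)
    (y : E) : postAvg ν r q y ^ 2 ≤ postAvg ν r (fun x => q x ^ 2) y :=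
  sq_integral_le (integrable_sq_tilted_logLik hqm hq y)

theorem integrable_sq_postAvg {q : E → ℝ} (hqm : Measurable q)
    (hq : Integrable (fun x => q x ^ 2) ν) :
    Integrable (fun p => postAvg ν r q p.2 ^ 2) (channelLaw ν r) := by
  have hm := (stronglyMeasurable_postAvg (ν := ν) (r := r) hqm.stronglyMeasurable).measurable
  refine (integrable_postAvg (r := r) hq (hqm.pow_const 2)).mono'
    (Measurable.aestronglyMeasurable (by fun_prop))
    (Filter.Eventually.of_forall fun p => ?_)
  rw [Real.norm_eq_abs, abs_of_nonneg (sq_nonneg _)]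
  exact sq_postAvg_le hqm hq p.2

/-- The posterior mean is the conditional expectation given the observation. -/
theorem integral_comp_fst_mul_comp_snd {q g : E → ℝ}
    (hqg : Integrable (fun p => q p.1 * g p.2) (channelLaw ν r))
    (hqg' : Integrable (fun p => postAvg ν r q p.2 * g p.2) (channelLaw ν r)) :
    ∫ p, q p.1 * g p.2 ∂(channelLaw ν r) = ∫ p, postAvg ν r q p.2 * g p.2 ∂(channelLaw ν r) := by
  rw [integral_channelLaw_eq_postAvg hqg,
    integral_comp_snd_channelLaw (g := fun y => postAvg ν r q y * g y) hqg']
  congr with y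
  simp only [postAvg]
  rw [integral_mul_const]

theorem sq_integral_mul_le {Ω : Type*} [MeasurableSpace Ω] {P : Measure Ω} {f g : Ω → ℝ}
    (hf : MemLp f 2 P) (hg : MemLp g 2 P) :
    (∫ x, f x * g x ∂P) ^ 2 ≤ (∫ x, f x ^ 2 ∂P) * ∫ x, g x ^ 2 ∂P := by
  have hf2 := hf.integrable_sq
  have hg2 := hg.integrable_sq
  have hfg : Integrable (fun x => f x * g x) P := hf.integrable_mul hg
  have h : ∀ t : ℝ, 0 ≤ (∫ x, g x ^ 2 ∂P) * (t * t) + (2 * ∫ x, f x * g x ∂P) * t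
      + ∫ x, f x ^ 2 ∂P := by
    intro t
    have h1 : 0 ≤ ∫ x, (f x + t * g x) ^ 2 ∂P := integral_nonneg fun x => sq_nonneg _
    have h2 : ∀ x, (f x + t * g x) ^ 2 = f x ^ 2 + 2 * t * (f x * g x) + t ^ 2 * g x ^ 2 :=
      fun x => by ring
    simp_rw [h2] at h1
    rw [integral_add (by fun_prop) (by fun_prop), integral_add (by fun_prop) (by fun_prop),
      integral_const_mul, integral_const_mul] at h1
    linarith
  have := discrim_le_zero h
  rw [discrim] at this
  linarith

/-- Contraction of the covariance with a bounded function of the observation. -/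
theorem IsMidpointLogConcave.sq_covariance_le {κ : ℝ} (hκ : 0 < κ) (hν : IsMidpointLogConcave κ ν)
    {q g : E → ℝ} (hqm : Measurable q) (hq : Integrable (fun x => q x ^ 2) ν) (hg : Measurable g)
    {K : ℝ} (hgK : ∀ x, |g x| ≤ K) (h : ℝ) :
    (κ + h ^ 2) * (∫ p, postAvg ν h q p.2 * g p.2 ∂(channelLaw ν h)
        - (∫ x, q x ∂ν) * ∫ p, g p.2 ∂(channelLaw ν h)) ^ 2
      ≤ h ^ 2 * (∫ x, q x ^ 2 ∂ν - (∫ x, q x ∂ν) ^ 2)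
        * (∫ p, g p.2 ^ 2 ∂(channelLaw ν h) - (∫ p, g p.2 ∂(channelLaw ν h)) ^ 2) := by
  have hqL : MemLp q 2 ν := (memLp_two_iff_integrable_sq hqm.aestronglyMeasurable).2 hq
  have hqi : Integrable q ν := hqL.integrable (by norm_num)
  have hpm := (stronglyMeasurable_postAvg (ν := ν) (r := h) hqm.stronglyMeasurable).measurable
  have hgi : Integrable (fun p : E × E => g p.2) (channelLaw ν h) :=
    integrable_of_bounded (by fun_prop) fun p => hgK p.2
  have hg2i : Integrable (fun p : E × E => g p.2 ^ 2) (channelLaw ν h) :=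
    integrable_of_bounded (by fun_prop) fun p => abs_sq_le_of_abs_le (hgK p.2)
  have hqgi : Integrable (fun p : E × E => q p.1 * g p.2) (channelLaw ν h) :=
    (integrable_comp_fst_channelLaw hqi).mul_bdd
      (Measurable.aestronglyMeasurable (by fun_prop))
      (Filter.Eventually.of_forall fun p => hgK p.2)
  have hqgi' : Integrable (fun p : E × E => postAvg ν h q p.2 * g p.2) (channelLaw ν h) :=
    (integrable_postAvg hqi hqm).mul_bdd
      (Measurable.aestronglyMeasurable (by fun_prop))
      (Filter.Eventually.of_forall fun p => hgK p.2)
  set f : E → ℝ := fun x => ∫ z, g (h • x + z) ∂(stdGaussian E) with hf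
  have hfm : Measurable f :=
    (StronglyMeasurable.integral_prod_right (f := fun x z => g (h • x + z))
      (Measurable.stronglyMeasurable (by fun_prop))).measurable
  have hfK : ∀ x, |f x| ≤ K := fun x => abs_integral_le_of_abs_le fun z => hgK _
  have hfi : Integrable f ν := integrable_of_bounded hfm hfK
  have hfL : MemLp f 2 ν := MemLp.of_bound hfm.aestronglyMeasurable K
    (Filter.Eventually.of_forall hfK)
  have hP := hν.variance_integral_stdGaussian_le hκ hg hgK h
  -- Move the covariance to the side of the signal: `𝔼[𝔼[q(X) | Y] g(Y)] = 𝔼[q(X) f(X)]`.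
  -- Cauchy-Schwarz then leaves only the variance of `f` to be bounded.
  rw [← integral_comp_fst_mul_comp_snd hqgi hqgi',
    integral_channelLaw_eq_integral_integral hqgi, integral_channelLaw_eq_integral_integral hgi,
    integral_channelLaw_eq_integral_integral hg2i]
  simp only [integral_const_mul]
  change κ * (∫ x, f x ^ 2 ∂ν - (∫ x, f x ∂ν) ^ 2) ≤ h ^ 2 * (_ - ∫ x, f x ^ 2 ∂ν) at hP
  change (κ + h ^ 2) * (∫ x, q x * f x ∂ν - (∫ x, q x ∂ν) * ∫ x, f x ∂ν) ^ 2 ≤ _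
  set G2 := ∫ x, ∫ z, g (h • x + z) ^ 2 ∂(stdGaussian E) ∂ν
  set c := ∫ x, q x ∂ν with hc
  set d := ∫ x, f x ∂ν with hd
  have e1 : ∫ x, (q x - c) * (f x - d) ∂ν = ∫ x, q x * f x ∂ν - c * d := by
    have hqf : Integrable (fun x => q x * f x) ν := hqL.integrable_mul hfL
    have e2 : ∀ x, (q x - c) * (f x - d) = q x * f x - d * q x - c * f x + c * d :=
      fun x => by ring
    simp_rw [e2]
    rw [integral_add, integral_sub, integral_sub, integral_const_mul, integral_const_mul, ← hc,
      ← hd]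
    · simp
      ring
    all_goals fun_prop
  have evar : ∀ u : E → ℝ, MemLp u 2 ν → ∫ x, (u x - ∫ x, u x ∂ν) ^ 2 ∂ν
      = ∫ x, u x ^ 2 ∂ν - (∫ x, u x ∂ν) ^ 2 := by
    intro u hu
    have h1 := variance_eq_sub hu
    rw [variance_eq_integral hu.aestronglyMeasurable.aemeasurable] at h1
    simpa using h1
  have hCS := sq_integral_mul_le (hqL.sub (memLp_const c)) (hfL.sub (memLp_const d))
  simp only [Pi.sub_apply] at hCS
  rw [e1, evar q hqL, evar f hfL] at hCS
  have hVq : 0 ≤ ∫ x, q x ^ 2 ∂ν - c ^ 2 := sub_nonneg.2 (sq_integral_le hqL)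
  have hκh : 0 < κ + h ^ 2 := by positivity
  calc (κ + h ^ 2) * (∫ x, q x * f x ∂ν - c * d) ^ 2
      ≤ (κ + h ^ 2) * ((∫ x, q x ^ 2 ∂ν - c ^ 2) * (∫ x, f x ^ 2 ∂ν - d ^ 2)) := by gcongr
    _ = (∫ x, q x ^ 2 ∂ν - c ^ 2) * ((κ + h ^ 2) * (∫ x, f x ^ 2 ∂ν - d ^ 2)) := by ring
    _ ≤ (∫ x, q x ^ 2 ∂ν - c ^ 2) * (h ^ 2 * (G2 - d ^ 2)) := by
        -- Adding `h² Var f` to both sides of `hP` turns the mean conditional variance on the right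
        -- into the full variance of `g(Y)`.
        refine mul_le_mul_of_nonneg_left ?_ hVq
        linarith
    _ = _ := by ring

/-- The variance of the posterior mean of a strongly log-concave signal contracts. -/
theorem IsMidpointLogConcave.variance_postAvg_le {κ : ℝ} (hκ : 0 < κ)
    (hν : IsMidpointLogConcave κ ν) {q : E → ℝ} (hqm : Measurable q)
    (hq : Integrable (fun x => q x ^ 2) ν) (h : ℝ) :
    (κ + h ^ 2) * (∫ p, postAvg ν h q p.2 ^ 2 ∂(channelLaw ν h) - (∫ x, q x ∂ν) ^ 2)
      ≤ h ^ 2 * (∫ x, q x ^ 2 ∂ν - (∫ x, q x ∂ν) ^ 2) := by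
  have hqL : MemLp q 2 ν := (memLp_two_iff_integrable_sq hqm.aestronglyMeasurable).2 hq
  have hqi : Integrable q ν := hqL.integrable (by norm_num)
  have hpm := (stronglyMeasurable_postAvg (ν := ν) (r := h) hqm.stronglyMeasurable).measurable
  set m : E → ℝ := postAvg ν h q with hm
  have hm2 : Integrable (fun p : E × E => m p.2 ^ 2) (channelLaw ν h) :=
    integrable_sq_postAvg hqm hq
  have hm1 : Integrable (fun p : E × E => m p.2) (channelLaw ν h) := integrable_postAvg hqi hqm
  have hmc : ∫ p : E × E, m p.2 ∂(channelLaw ν h) = ∫ x, q x ∂ν := integral_postAvg hqi hqm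
  -- The covariance bound is to be tested on the posterior mean itself, which may be unbounded;
  -- hence truncations and dominated convergence.
  set g : ℕ → E → ℝ := fun N y => max (-(N : ℝ)) (min N (m y)) with hg
  have hgm : ∀ N, Measurable (g N) := fun N => by fun_prop
  have hgN : ∀ N y, |g N y| ≤ N := by
    intro N y
    have hN : (0 : ℝ) ≤ N := N.cast_nonneg
    exact abs_le.2 ⟨le_max_left _ _, max_le (by linarith) (min_le_left _ _)⟩
  have hgle : ∀ N y, |g N y| ≤ |m y| := by
    intro N y
    have hN : (0 : ℝ) ≤ N := N.cast_nonneg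
    have h1 := neg_abs_le (m y)
    have h2 := le_abs_self (m y)
    have h3 := abs_nonneg (m y)
    refine abs_le.2 ⟨le_max_of_le_right (le_min (by linarith) h1),
      max_le (by linarith) ((min_le_right _ _).trans h2)⟩
  have hglim : ∀ y, Filter.Tendsto (fun N => g N y) Filter.atTop (nhds (m y)) := by
    intro y
    obtain ⟨N0, hN0⟩ := exists_nat_ge |m y|
    refine tendsto_const_nhds.congr' ?_
    filter_upwards [Filter.eventually_ge_atTop N0] with N hN
    have h1 : |m y| ≤ N := hN0.trans (by exact_mod_cast hN)
    rw [abs_le] at h1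
    simp only [hg]
    rw [min_eq_right h1.2, max_eq_right h1.1]
  have hbound := fun N => hν.sq_covariance_le hκ hqm hq (hgm N) (hgN N) h
  have l1 : Filter.Tendsto (fun N => ∫ p : E × E, m p.2 * g N p.2 ∂(channelLaw ν h)) Filter.atTop
      (nhds (∫ p : E × E, m p.2 ^ 2 ∂(channelLaw ν h))) := by
    refine tendsto_integral_of_dominated_convergence _
      (fun N => Measurable.aestronglyMeasurable (by fun_prop)) hm2
      (fun N => Filter.Eventually.of_forall fun p => ?_) (Filter.Eventually.of_forall fun p => ?_)
    · rw [norm_mul, Real.norm_eq_abs, Real.norm_eq_abs, ← sq_abs, pow_two]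
      exact mul_le_mul_of_nonneg_left (hgle N _) (abs_nonneg _)
    · rw [pow_two]
      exact (hglim p.2).const_mul _
  have l2 : Filter.Tendsto (fun N => ∫ p : E × E, g N p.2 ∂(channelLaw ν h)) Filter.atTop
      (nhds (∫ x, q x ∂ν)) := by
    rw [← hmc]
    exact tendsto_integral_of_dominated_convergence _
      (fun N => Measurable.aestronglyMeasurable (by fun_prop)) hm1.abs
      (fun N => Filter.Eventually.of_forall fun p => hgle N _)
      (Filter.Eventually.of_forall fun p => hglim _)
  have l3 : Filter.Tendsto (fun N => ∫ p : E × E, g N p.2 ^ 2 ∂(channelLaw ν h)) Filter.atTop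
      (nhds (∫ p : E × E, m p.2 ^ 2 ∂(channelLaw ν h))) := by
    refine tendsto_integral_of_dominated_convergence _
      (fun N => Measurable.aestronglyMeasurable (by fun_prop)) hm2
      (fun N => Filter.Eventually.of_forall fun p => ?_)
      (Filter.Eventually.of_forall fun p => (hglim _).pow 2)
    rw [norm_pow, ← sq_abs (m _)]
    exact pow_le_pow_left₀ (norm_nonneg _) (hgle N _) 2
  set T := ∫ p : E × E, m p.2 ^ 2 ∂(channelLaw ν h) with hT
  set c := ∫ x, q x ∂ν with hc
  have hlim := le_of_tendsto_of_tendsto' (((l1.sub (l2.const_mul c)).pow 2).const_mul (κ + h ^ 2))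
    ((l3.sub (l2.pow 2)).const_mul (h ^ 2 * (∫ x, q x ^ 2 ∂ν - c ^ 2))) hbound
  have hTc : 0 ≤ T - c ^ 2 := by
    have := sq_integral_le ((memLp_two_iff_integrable_sq
      (Measurable.aestronglyMeasurable (by fun_prop))).2 hm2)
    rw [hmc] at this
    exact sub_nonneg.2 this
  have hVq : 0 ≤ ∫ x, q x ^ 2 ∂ν - c ^ 2 := sub_nonneg.2 (sq_integral_le hqL)
  -- In the limit the variance `T - c²` of the posterior mean appears squared on the left and once
  -- on the right; unless it vanishes, one factor cancels.
  rcases hTc.eq_or_lt with h0 | h0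
  · rw [← h0, mul_zero]
    positivity
  · refine le_of_mul_le_mul_right ?_ h0
    linarith

/-- The expected squared norm of the posterior mean. -/
noncomputable def postEnergy (ν : Measure E) (r : ℝ) : ℝ :=
  ∫ p, ‖postAvg ν r id p.2‖ ^ 2 ∂(channelLaw ν r)

theorem integrable_of_integrable_norm_sq {ν : Measure E} [IsFiniteMeasure ν]
    (hν2 : Integrable (fun x => ‖x‖ ^ 2) ν) : Integrable (fun x : E => x) ν :=
  ((memLp_two_iff_integrable_sq_norm (f := fun x : E => x) (by fun_prop)).2 hν2).integrable
    (by norm_num)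

theorem integrable_inner_sq (hν2 : Integrable (fun x => ‖x‖ ^ 2) ν) (b : E) :
    Integrable (fun x => inner ℝ b x ^ 2) ν := by
  refine (hν2.const_mul (‖b‖ ^ 2)).mono' (by fun_prop) (Filter.Eventually.of_forall fun x => ?_)
  rw [norm_pow, ← mul_pow]
  exact pow_le_pow_left₀ (norm_nonneg _) (norm_inner_le_norm b x) 2

theorem inner_postAvg (hν2 : Integrable (fun x => ‖x‖ ^ 2) ν) (b y : E) :
    inner ℝ b (postAvg ν r id y) = postAvg ν r (fun x => inner ℝ b x) y :=
  (integral_inner ((integrable_of_integrable_norm_sq hν2).tilted_logLik r y) b).symm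

@[fun_prop]
theorem measurable_postAvg_id : Measurable (postAvg ν r (id : E → E)) :=
  (stronglyMeasurable_postAvg stronglyMeasurable_id).measurable

theorem norm_sq_postAvg_le (hν2 : Integrable (fun x => ‖x‖ ^ 2) ν) (y : E) :
    ‖postAvg ν r id y‖ ^ 2 ≤ postAvg ν r (fun x => ‖x‖ ^ 2) y := by
  have h1 : ‖postAvg ν r id y‖ ≤ postAvg ν r (fun x => ‖x‖) y := norm_integral_le_integral_norm _
  exact (pow_le_pow_left₀ (norm_nonneg _) h1 2).trans (sq_postAvg_le (by fun_prop) hν2 y)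

theorem integrable_norm_sq_postAvg (hν2 : Integrable (fun x => ‖x‖ ^ 2) ν) :
    Integrable (fun p => ‖postAvg ν r id p.2‖ ^ 2) (channelLaw ν r) := by
  refine (integrable_postAvg (r := r) hν2 (by fun_prop)).mono'
    (Measurable.aestronglyMeasurable (by fun_prop))
    (Filter.Eventually.of_forall fun p => ?_)
  rw [Real.norm_eq_abs, abs_of_nonneg (sq_nonneg _)]
  exact norm_sq_postAvg_le hν2 p.2

/-- Sum of the scalar contraction over the coordinates in an orthonormal basis. -/
theorem IsMidpointLogConcave.postEnergy_sub_le {κ : ℝ} (hκ : 0 < κ)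
    (hν : IsMidpointLogConcave κ ν) (h : ℝ) :
    (κ + h ^ 2) * (postEnergy ν h - ‖∫ x, x ∂ν‖ ^ 2)
      ≤ h ^ 2 * (∫ x, ‖x‖ ^ 2 ∂ν - ‖∫ x, x ∂ν‖ ^ 2) := by
  have hν2 := hν.integrable_norm_sq hκ
  set b := stdOrthonormalBasis ℝ E
  have hb : ∀ x : E, ‖x‖ ^ 2 = ∑ i, inner ℝ (b i) x ^ 2 := fun x => (b.sum_sq_inner_right x).symm
  have h1 := fun i => hν.variance_postAvg_le hκ (q := fun x => inner ℝ (b i) x) (by fun_prop)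
    (integrable_inner_sq hν2 (b i)) h
  have h2 := Finset.sum_le_sum fun i (_ : i ∈ Finset.univ) => h1 i
  rw [← Finset.mul_sum, ← Finset.mul_sum, Finset.sum_sub_distrib, Finset.sum_sub_distrib,
    ← integral_finsetSum _ fun i _ => integrable_sq_postAvg (by fun_prop)
      (integrable_inner_sq hν2 (b i)),
    ← integral_finsetSum _ fun i _ => integrable_inner_sq hν2 (b i)] at h2
  simp_rw [integral_inner (integrable_of_integrable_norm_sq hν2), ← inner_postAvg hν2, ← hb] at h2
  exact h2

end Channel

/-! ### Splitting an observation, and monotonicity of the weighted mean square error. -/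

section Monotonicity

variable {E : Type*} [NormedAddCommGroup E] [InnerProductSpace ℝ E] [FiniteDimensional ℝ E]
  [MeasurableSpace E] [BorelSpace E] {ν : Measure E} [IsProbabilityMeasure ν]

theorem tilted_logLik_tilted_logLik {r h q : ℝ} (hq : q ≠ 0) (hrh : r ^ 2 + h ^ 2 = q ^ 2)
    (y z : E) : (ν.tilted (logLik r y)).tilted (logLik h z)
      = ν.tilted (logLik q ((r / q) • y + (h / q) • z)) := by
  have h1 : logLik r y + logLik h z = logLik q ((r / q) • y + (h / q) • z) :=
    funext fun x => logLik_add hq hrh y z x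
  rw [tilted_tilted (integrable_exp_logLik r y), h1]

/-- Chain rule for densities: the second observation is predicted with the posterior of the first as
prior, and the product depends only on the sufficient statistic. -/
theorem evidence_mul_evidence_tilted {r h q : ℝ} (hq : q ≠ 0) (hrh : r ^ 2 + h ^ 2 = q ^ 2)
    (y z : E) : evidence ν r y * evidence (ν.tilted (logLik r y)) h z
      = evidence ν q ((r / q) • y + (h / q) • z) := by
  have h1 := evidence_mul_postAvg (ν := ν) (r := r) (fun x => Real.exp (logLik h z x)) y
  rw [postAvg] at h1
  rw [evidence.eq_def (ν.tilted _), h1, evidence]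
  simp_rw [← Real.exp_add, logLik_add hq hrh]

theorem postEnergy_eq (hν2 : Integrable (fun x => ‖x‖ ^ 2) ν) (r : ℝ) :
    postEnergy ν r = ∫ y, evidence ν r y * ‖postAvg ν r id y‖ ^ 2 ∂(stdGaussian E) :=
  integral_comp_snd_channelLaw (g := fun y => ‖postAvg ν r id y‖ ^ 2)
    (integrable_norm_sq_postAvg hν2)

theorem integrable_evidence_mul_norm_sq (hν2 : Integrable (fun x => ‖x‖ ^ 2) ν) (r : ℝ) :
    Integrable (fun y => evidence ν r y * ‖postAvg ν r id y‖ ^ 2) (stdGaussian E) :=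
  (integrable_comp_snd_channelLaw_iff (g := fun y => ‖postAvg ν r id y‖ ^ 2) (by fun_prop)).1
    (integrable_norm_sq_postAvg hν2)

/-- Decomposition of the energy of the posterior mean by splitting the observation. -/
theorem postEnergy_eq_integral_postEnergy (hν2 : Integrable (fun x => ‖x‖ ^ 2) ν) {r h q : ℝ}
    (hq : q ≠ 0) (hrh : r ^ 2 + h ^ 2 = q ^ 2) :
    Integrable (fun y => evidence ν r y * postEnergy (ν.tilted (logLik r y)) h) (stdGaussian E) ∧
    postEnergy ν q
      = ∫ y, evidence ν r y * postEnergy (ν.tilted (logLik r y)) h ∂(stdGaussian E) := by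
  set G : E → ℝ := fun y => evidence ν q y * ‖postAvg ν q id y‖ ^ 2 with hG
  have hGm : Measurable G := by fun_prop
  -- Under the Gaussian reference law, the merged observation is again standard Gaussian, so an
  -- integral over it becomes a double integral over the two partial ones.
  have hrot := map_rotation_stdGaussian (E := E) (a := r / q) (b := h / q) (by
    rw [div_pow, div_pow, ← add_div, hrh]
    exact div_self (pow_ne_zero 2 hq))
  have hGi : Integrable G (stdGaussian E) := integrable_evidence_mul_norm_sq hν2 q
  have hGi' : Integrable (fun p : E × E => G ((r / q) • p.1 + (h / q) • p.2))
      ((stdGaussian E).prod (stdGaussian E)) := by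
    rw [← hrot] at hGi
    exact (integrable_map_measure hGm.aestronglyMeasurable (by fun_prop)).1 hGi
  have hinner : ∀ y, evidence ν r y * postEnergy (ν.tilted (logLik r y)) h
      = ∫ z, G ((r / q) • y + (h / q) • z) ∂(stdGaussian E) := by
    intro y
    rw [postEnergy_eq (hν2.tilted_logLik r y), ← integral_const_mul]
    congr with z
    rw [← mul_assoc, evidence_mul_evidence_tilted hq hrh, postAvg,
      tilted_logLik_tilted_logLik hq hrh]
    rfl
  simp_rw [hinner]
  refine ⟨hGi'.integral_prod_left, ?_⟩
  rw [postEnergy_eq hν2]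
  change ∫ y, G y ∂(stdGaussian E) = _
  conv_lhs => rw [← hrot]
  rw [integral_map (by fun_prop) hGm.aestronglyMeasurable, integral_prod _ hGi']

/-- The minimal mean square error of estimating the signal from the observation. -/
noncomputable def mmse (ν : Measure E) (r : ℝ) : ℝ := ∫ x, ‖x‖ ^ 2 ∂ν - postEnergy ν r

theorem postEnergy_le (hν2 : Integrable (fun x => ‖x‖ ^ 2) ν) (r : ℝ) :
    postEnergy ν r ≤ ∫ x, ‖x‖ ^ 2 ∂ν := by
  rw [← integral_postAvg (r := r) hν2 (by fun_prop)]
  exact integral_mono (integrable_norm_sq_postAvg hν2) (integrable_postAvg hν2 (by fun_prop))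
    fun p => norm_sq_postAvg_le hν2 p.2

theorem mmse_nonneg (hν2 : Integrable (fun x => ‖x‖ ^ 2) ν) (r : ℝ) : 0 ≤ mmse ν r :=
  sub_nonneg.2 (postEnergy_le hν2 r)

/-- For a `κ`-strongly log-concave signal, `(κ + r ^ 2) * mmse r` is nondecreasing. -/
theorem IsMidpointLogConcave.mul_mmse_le {κ : ℝ} (hκ : 0 < κ) (hν : IsMidpointLogConcave κ ν)
    {r q : ℝ} (hr : 0 ≤ r) (hrq : r ≤ q) :
    (κ + r ^ 2) * mmse ν r ≤ (κ + q ^ 2) * mmse ν q := by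
  have hν2 := hν.integrable_norm_sq hκ
  rcases hrq.eq_or_lt with rfl | hlt
  · exact le_rfl
  have hq : 0 < q := hr.trans_lt hlt
  set h := √(q ^ 2 - r ^ 2) with hh
  have hh2 : h ^ 2 = q ^ 2 - r ^ 2 := Real.sq_sqrt (by nlinarith)
  have hrh : r ^ 2 + h ^ 2 = q ^ 2 := by rw [hh2]; ring
  obtain ⟨hi, he⟩ := postEnergy_eq_integral_postEnergy hν2 hq.ne' hrh
  have hκr : 0 < κ + r ^ 2 := by positivity
  have hκq : 0 < κ + q ^ 2 := by positivity
  have hA := integrable_evidence_mul_norm_sq hν2 r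
  have hM : Integrable (fun y => evidence ν r y * postAvg ν r (fun x => ‖x‖ ^ 2) y)
      (stdGaussian E) :=
    integrable_evidence_mul_postAvg (integrable_comp_fst_channelLaw hν2)
  have hMe : ∫ y, evidence ν r y * postAvg ν r (fun x => ‖x‖ ^ 2) y ∂(stdGaussian E)
      = ∫ x, ‖x‖ ^ 2 ∂ν := by
    rw [← integral_comp_fst_channelLaw (r := r) hν2,
      integral_channelLaw_eq_postAvg (integrable_comp_fst_channelLaw hν2)]
  -- Given the first observation `y` the signal is `(κ + r²)`-strongly log-concave, so the
  -- contraction holds for the second one with constant `κ + r² + h² = κ + q²`. Averaging over `y`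
  -- gives the claim.
  have hpt : ∀ y, (κ + q ^ 2) * (evidence ν r y * postEnergy (ν.tilted (logLik r y)) h)
      ≤ (κ + r ^ 2) * (evidence ν r y * ‖postAvg ν r id y‖ ^ 2)
        + h ^ 2 * (evidence ν r y * postAvg ν r (fun x => ‖x‖ ^ 2) y) := by
    intro y
    have h1 := (hν.tilted_logLik r y).postEnergy_sub_le hκr h
    rw [show κ + r ^ 2 + h ^ 2 = κ + q ^ 2 by rw [← hrh]; ring] at h1
    have h2 := mul_le_mul_of_nonneg_left h1 (evidence_pos ν r y).le
    change evidence ν r y * ((κ + q ^ 2) * (_ - ‖postAvg ν r id y‖ ^ 2))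
      ≤ evidence ν r y * (h ^ 2 * (postAvg ν r (fun x => ‖x‖ ^ 2) y - ‖postAvg ν r id y‖ ^ 2)) at h2
    have h3 : h ^ 2 * (evidence ν r y * ‖postAvg ν r id y‖ ^ 2)
      = (q ^ 2 - r ^ 2) * (evidence ν r y * ‖postAvg ν r id y‖ ^ 2) := by rw [hh2]
    linarith
  have hint := integral_mono (hi.const_mul _) ((hA.const_mul _).add (hM.const_mul _)) hpt
  simp only [Pi.add_apply] at hint
  rw [integral_add (hA.const_mul _) (hM.const_mul _), integral_const_mul, integral_const_mul,
    integral_const_mul, ← he, ← postEnergy_eq hν2, hMe, hh2] at hint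
  unfold mmse
  linarith

end Monotonicity

/-! ### Differentiating the channel information: the I-MMSE formula. -/

section Information

variable {E : Type*} [NormedAddCommGroup E] [InnerProductSpace ℝ E] [FiniteDimensional ℝ E]
  [MeasurableSpace E] [BorelSpace E] {ν : Measure E} [IsProbabilityMeasure ν] {r : ℝ}

theorem integrable_logLik (hν2 : Integrable (fun x => ‖x‖ ^ 2) ν) (r : ℝ) (y : E) :
    Integrable (logLik r y) ν := by
  have hid := integrable_of_integrable_norm_sq hν2
  have h1 : Integrable (fun x => inner ℝ x y) ν := hid.inner_const y
  unfold logLik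
  fun_prop

theorem integral_logLik (hν2 : Integrable (fun x => ‖x‖ ^ 2) ν) (r : ℝ) (y : E) :
    ∫ x, logLik r y x ∂ν = r * inner ℝ (∫ x, x ∂ν) y - r ^ 2 * (∫ x, ‖x‖ ^ 2 ∂ν) / 2 := by
  have hid := integrable_of_integrable_norm_sq hν2
  have h1 : Integrable (fun x => inner ℝ x y) ν := hid.inner_const y
  have h2 : ∫ x, inner ℝ x y ∂ν = inner ℝ (∫ x, x ∂ν) y := by
    rw [real_inner_comm, ← integral_inner hid]
    simp_rw [real_inner_comm]
  unfold logLik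
  rw [integral_sub (by fun_prop) (by fun_prop), integral_const_mul, integral_div,
    integral_const_mul, h2]

theorem norm_sq_integral_le (hν2 : Integrable (fun x => ‖x‖ ^ 2) ν) :
    ‖∫ x, x ∂ν‖ ^ 2 ≤ ∫ x, ‖x‖ ^ 2 ∂ν := by
  have h1 : ‖∫ x, x ∂ν‖ ≤ ∫ x, ‖x‖ ∂ν := norm_integral_le_integral_norm _
  refine (pow_le_pow_left₀ (norm_nonneg _) h1 2).trans (sq_integral_le ?_)
  exact ((memLp_two_iff_integrable_sq_norm (f := fun x : E => x) (by fun_prop)).2 hν2).norm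

theorem abs_mul_inner_integral_le (hν2 : Integrable (fun x => ‖x‖ ^ 2) ν) (r : ℝ) (y : E) :
    |r * inner ℝ (∫ x, x ∂ν) y| ≤ r ^ 2 * (∫ x, ‖x‖ ^ 2 ∂ν) / 4 + ‖y‖ ^ 2 := by
  have h1 := norm_sq_integral_le hν2
  have h2 := abs_real_inner_le_norm (∫ x, x ∂ν) y
  rw [abs_mul]
  have h3 : |r| * |inner ℝ (∫ x, x ∂ν) y| ≤ |r| * (‖∫ x, x ∂ν‖ * ‖y‖) := by gcongr
  have h4 := sq_nonneg (|r| * ‖∫ x, x ∂ν‖ / 2 - ‖y‖)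
  have h5 : r ^ 2 * ‖∫ x, x ∂ν‖ ^ 2 ≤ r ^ 2 * ∫ x, ‖x‖ ^ 2 ∂ν := by gcongr
  rw [← sq_abs r] at h5 ⊢
  linarith

/-- Jensen's inequality, obtained by integrating the tangent line of `exp` at the mean `c`. -/
theorem exp_integral_logLik_le_evidence (hν2 : Integrable (fun x => ‖x‖ ^ 2) ν) (r : ℝ) (y : E) :
    Real.exp (∫ x, logLik r y x ∂ν) ≤ evidence ν r y := by
  set c := ∫ x, logLik r y x ∂ν with hc
  have hi := integrable_logLik hν2 r y
  have h1 : ∫ x, Real.exp c * (1 + (logLik r y x - c)) ∂ν = Real.exp c := by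
    rw [integral_const_mul, integral_add (integrable_const _) (by fun_prop),
      integral_sub hi (integrable_const _)]
    simp [← hc]
  rw [← h1]
  refine integral_mono (by fun_prop) (integrable_exp_logLik r y) fun x => ?_
  have h2 := Real.add_one_le_exp (logLik r y x - c)
  have h3 : Real.exp (logLik r y x) = Real.exp c * Real.exp (logLik r y x - c) := by
    rw [← Real.exp_add]; ring_nf
  simp only
  rw [h3]
  gcongr
  linarith

/-- The log-likelihood is larger on average under the posterior than under the prior. -/
theorem integral_logLik_le_postAvg (hν2 : Integrable (fun x => ‖x‖ ^ 2) ν) (r : ℝ) (y : E) :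
    ∫ x, logLik r y x ∂ν ≤ postAvg ν r (logLik r y) y := by
  set c := ∫ x, logLik r y x ∂ν with hc
  have hi := integrable_logLik hν2 r y
  have hp := (hi.tilted_logLik r y).sub (integrable_const c)
  have h1 : postAvg ν r (fun x => logLik r y x - c) y = postAvg ν r (logLik r y) y - c := by
    rw [postAvg, integral_sub (hi.tilted_logLik r y) (integrable_const _)]
    simp [postAvg]
  have h2 : 0 ≤ evidence ν r y * postAvg ν r (fun x => logLik r y x - c) y := by
    rw [evidence_mul_postAvg]
    -- Subtracting this null integral leaves `(e^L - e^c)(L - c) ≥ 0` under the integral, where `L`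
    -- is the log-likelihood.
    have h3 : ∫ x, Real.exp c * (logLik r y x - c) ∂ν = 0 := by
      rw [integral_const_mul, integral_sub hi (integrable_const _)]
      simp [← hc]
    rw [← h3]
    refine integral_mono (by fun_prop)
      (integrable_exp_logLik_smul (hi.sub (integrable_const c)) y) fun x => ?_
    simp only
    rcases le_total c (logLik r y x) with h | h
    · exact mul_le_mul_of_nonneg_right (Real.exp_le_exp.2 h) (sub_nonneg.2 h)
    · exact mul_le_mul_of_nonpos_right (Real.exp_le_exp.2 h) (sub_nonpos.2 h)
  have h4 := nonneg_of_mul_nonneg_right h2 (evidence_pos ν r y)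
  linarith

/-- A bound for the second moment of the posterior. -/
theorem postAvg_norm_sq_le (hν2 : Integrable (fun x => ‖x‖ ^ 2) ν) (r : ℝ) (y : E) :
    r ^ 2 * postAvg ν r (fun x => ‖x‖ ^ 2) y ≤ 8 * ‖y‖ ^ 2 + 3 * (r ^ 2 * ∫ x, ‖x‖ ^ 2 ∂ν) := by
  have h1 := integral_logLik_le_postAvg hν2 r y
  rw [integral_logLik hν2] at h1
  have h2 := (abs_le.1 (abs_mul_inner_integral_le hν2 r y)).1
  have h3 : postAvg ν r (logLik r y) y
      ≤ ‖y‖ ^ 2 - r ^ 2 / 4 * postAvg ν r (fun x => ‖x‖ ^ 2) y := by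
    have hi := (integrable_logLik hν2 r y).tilted_logLik r y
    have h2i := hν2.tilted_logLik r y
    have h4 : ∫ x, (‖y‖ ^ 2 - r ^ 2 / 4 * ‖x‖ ^ 2) ∂(ν.tilted (logLik r y))
        = ‖y‖ ^ 2 - r ^ 2 / 4 * postAvg ν r (fun x => ‖x‖ ^ 2) y := by
      rw [integral_sub (integrable_const _) (by fun_prop), integral_const_mul]
      simp [postAvg]
    rw [← h4, postAvg]
    refine integral_mono hi (by fun_prop) fun x => ?_
    -- This square gives `logLik r y x ≤ ‖y‖² - r² ‖x‖² / 4`, keeping half of the quadratic decay so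
    -- as to control the second moment.
    have h5 := sq_nonneg ‖y - (r / 2) • x‖
    rw [norm_sub_sq_real, inner_smul_right, norm_smul, mul_pow, Real.norm_eq_abs, sq_abs,
      real_inner_comm] at h5
    simp only [logLik]
    linarith
  linarith

/-- Bounded likelihood gives the upper bound and Jensen the lower one. Quadratic growth in `y`
suffices for integrability under the channel. -/
theorem abs_log_evidence_le (hν2 : Integrable (fun x => ‖x‖ ^ 2) ν) (r : ℝ) (y : E) :
    |Real.log (evidence ν r y)| ≤ ‖y‖ ^ 2 + r ^ 2 * ∫ x, ‖x‖ ^ 2 ∂ν := by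
  have h0 := evidence_pos ν r y
  have h1 := exp_integral_logLik_le_evidence hν2 r y
  rw [← Real.le_log_iff_exp_le h0, integral_logLik hν2] at h1
  have h2 := evidence_le (ν := ν) (r := r) y
  rw [← Real.log_le_iff_le_exp h0] at h2
  have h3 := (abs_le.1 (abs_mul_inner_integral_le hν2 r y)).1
  have h4 : 0 ≤ r ^ 2 * ∫ x, ‖x‖ ^ 2 ∂ν :=
    mul_nonneg (sq_nonneg _) (integral_nonneg fun x => sq_nonneg _)
  rw [abs_le]
  constructor <;> nlinarith [sq_nonneg ‖y‖]

theorem norm_smul_add_sq_le (r : ℝ) (x z : E) :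
    ‖r • x + z‖ ^ 2 ≤ 2 * (r ^ 2 * ‖x‖ ^ 2) + 2 * ‖z‖ ^ 2 := by
  have h1 := parallelogram_law_with_norm ℝ (r • x) z
  have h2 := sq_nonneg ‖r • x - z‖
  rw [norm_smul, Real.norm_eq_abs] at h1
  rw [← sq_abs r]
  linarith

theorem integrable_fst_snd_norm_sq (hν2 : Integrable (fun x => ‖x‖ ^ 2) ν) :
    Integrable (fun p : E × E => ‖p.1‖ ^ 2) (ν.prod (stdGaussian E)) ∧
    Integrable (fun p : E × E => ‖p.2‖ ^ 2) (ν.prod (stdGaussian E)) :=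
  ⟨hν2.comp_fst _, integrable_norm_sq_stdGaussian.comp_snd _⟩

theorem integrable_channelLaw_of_le (hν2 : Integrable (fun x => ‖x‖ ^ 2) ν) {G : E × E → ℝ}
    (hG : Measurable G) {A B C : ℝ}
    (hle : ∀ p, |G p| ≤ A + B * ‖p.1‖ ^ 2 + C * ‖p.2‖ ^ 2) (hC : 0 ≤ C) :
    Integrable G (channelLaw ν r) := by
  rw [channelLaw, integrable_map_measure hG.aestronglyMeasurable (by fun_prop)]
  obtain ⟨h1, h2⟩ := integrable_fst_snd_norm_sq hν2
  have h3 : Integrable (fun p : E × E => A + B * ‖p.1‖ ^ 2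
      + C * (2 * (r ^ 2 * ‖p.1‖ ^ 2) + 2 * ‖p.2‖ ^ 2)) (ν.prod (stdGaussian E)) := by fun_prop
  refine h3.mono' (Measurable.aestronglyMeasurable (by fun_prop))
    (Filter.Eventually.of_forall fun p => (hle _).trans ?_)
  have := norm_smul_add_sq_le r p.1 p.2
  gcongr

theorem integral_inner_channelLaw (hν2 : Integrable (fun x => ‖x‖ ^ 2) ν) :
    Integrable (fun p : E × E => inner ℝ p.1 p.2) (channelLaw ν r) ∧
    ∫ p, inner ℝ p.1 p.2 ∂(channelLaw ν r) = r * ∫ x, ‖x‖ ^ 2 ∂ν := by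
  have hi : Integrable (fun p : E × E => inner ℝ p.1 p.2) (channelLaw ν r) := by
    refine integrable_channelLaw_of_le hν2 (by fun_prop) (A := 0) (B := 1) (C := 1) (fun p => ?_)
      zero_le_one
    have h1 := abs_real_inner_le_norm p.1 p.2
    nlinarith [sq_nonneg (‖p.1‖ - ‖p.2‖), sq_nonneg ‖p.1‖, sq_nonneg ‖p.2‖]
  refine ⟨hi, ?_⟩
  rw [integral_channelLaw_eq_integral_integral hi, ← integral_const_mul]
  congr with x
  simp only [inner_add_right, inner_smul_right, real_inner_self_eq_norm_sq]
  rw [integral_add (integrable_const _) (integrable_inner_stdGaussian x),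
    integral_inner_stdGaussian]
  simp

/-- The relative entropy of the law of the observation with respect to the standard Gaussian. -/
noncomputable def outputEntropy (ν : Measure E) (r : ℝ) : ℝ :=
  ∫ p, Real.log (evidence ν r p.2) ∂(channelLaw ν r)

theorem integrable_log_evidence (hν2 : Integrable (fun x => ‖x‖ ^ 2) ν) (r : ℝ) :
    Integrable (fun p : E × E => Real.log (evidence ν r p.2)) (channelLaw ν r) := by
  refine integrable_channelLaw_of_le hν2 (by fun_prop) (A := r ^ 2 * ∫ x, ‖x‖ ^ 2 ∂ν) (B := 0)
    (C := 1) (fun p => ?_) zero_le_one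
  have := abs_log_evidence_le hν2 r p.2
  linarith

/-- The signal `x` and the noise `z` are frozen, so the observation `r • x + z` moves with `r`; this
produces the extra term `r • x`. -/
theorem hasDerivAt_logLik (x z w : E) (r : ℝ) :
    HasDerivAt (fun r : ℝ => logLik r (r • x + z) w)
      (inner ℝ (r • x + z + r • x) w - r * ‖w‖ ^ 2) r := by
  have h1 : (fun r : ℝ => logLik r (r • x + z) w)
      = fun r : ℝ => r ^ 2 * (inner ℝ w x - ‖w‖ ^ 2 / 2) + r * inner ℝ w z := by
    funext r
    simp only [logLik, inner_add_right, inner_smul_right]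
    ring
  rw [h1]
  have h2 := ((hasDerivAt_pow 2 r).mul_const (inner ℝ w x - ‖w‖ ^ 2 / 2)).add
    ((hasDerivAt_id r).mul_const (inner ℝ w z))
  refine h2.congr_deriv ?_
  simp only [inner_add_left, inner_smul_left, conj_trivial, real_inner_comm w x,
    real_inner_comm w z]
  push_cast
  ring

theorem hasDerivAt_evidence (hν2 : Integrable (fun x => ‖x‖ ^ 2) ν) (x z : E) (r : ℝ) :
    HasDerivAt (fun r : ℝ => evidence ν r (r • x + z))
      (∫ w, Real.exp (logLik r (r • x + z) w) *
        (inner ℝ (r • x + z + r • x) w - r * ‖w‖ ^ 2) ∂ν) r := by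
  have hid := integrable_of_integrable_norm_sq hν2
  set R := |r| + 1 with hR
  have hR0 : 0 ≤ R := by positivity
  set c := R * ‖x‖ + ‖z‖ with hc
  have hball : ∀ s ∈ Metric.ball r 1, |s| ≤ R := by
    intro s hs
    rw [Metric.mem_ball, Real.dist_eq] at hs
    have := abs_sub_abs_le_abs_sub s r
    linarith
  refine (hasDerivAt_integral_of_dominated_loc_of_deriv_le
    (F := fun s w => Real.exp (logLik s (s • x + z) w))
    (F' := fun s w => Real.exp (logLik s (s • x + z) w) *
        (inner ℝ (s • x + z + s • x) w - s * ‖w‖ ^ 2))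
    (bound := fun w => Real.exp (c ^ 2 / 2) * ((c + R * ‖x‖) * ‖w‖ + R * ‖w‖ ^ 2))
    (Metric.ball_mem_nhds r one_pos)
    (Filter.Eventually.of_forall fun s => by fun_prop) (integrable_exp_logLik r _)
    (by fun_prop) (Filter.Eventually.of_forall fun w s hs => ?_) ?_
    (Filter.Eventually.of_forall fun w s _ => ?_)).2
  · have hs' := hball s hs
    have hy : ‖s • x + z‖ ≤ c := by
      refine (norm_add_le _ _).trans ?_
      rw [norm_smul, Real.norm_eq_abs]
      simp only [hc]
      gcongr
    rw [norm_mul, Real.norm_eq_abs, Real.abs_exp, Real.norm_eq_abs]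
    refine mul_le_mul (Real.exp_le_exp.2 ((logLik_le _ _ _).trans ?_)) ?_ (abs_nonneg _)
      (Real.exp_nonneg _)
    · gcongr
    · refine (abs_sub _ _).trans (add_le_add ((abs_real_inner_le_norm _ _).trans ?_) ?_)
      · gcongr
        refine (norm_add_le _ _).trans ?_
        rw [norm_smul s x, Real.norm_eq_abs]
        gcongr
      · rw [abs_mul, abs_of_nonneg (sq_nonneg ‖w‖)]
        gcongr
  · have := hid.norm
    fun_prop
  · exact (hasDerivAt_logLik x z w s).exp

theorem hasDerivAt_log_evidence (hν2 : Integrable (fun x => ‖x‖ ^ 2) ν) (x z : E) (r : ℝ) :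
    HasDerivAt (fun r : ℝ => Real.log (evidence ν r (r • x + z)))
      (inner ℝ (r • x + z + r • x) (postAvg ν r id (r • x + z))
        - r * postAvg ν r (fun w => ‖w‖ ^ 2) (r • x + z)) r := by
  have hid := integrable_of_integrable_norm_sq hν2
  refine ((hasDerivAt_evidence hν2 x z r).log (evidence_pos ν r _).ne').congr_deriv ?_
  set y := r • x + z with hy
  rw [← evidence_mul_postAvg, mul_div_cancel_left₀ _ (evidence_pos ν r y).ne', inner_postAvg hν2]
  simp only [postAvg]
  have h1 : Integrable (fun w => inner ℝ (y + r • x) w) (ν.tilted (logLik r y)) :=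
    (hid.const_inner _).tilted_logLik r y
  have h2 := hν2.tilted_logLik r y
  rw [integral_sub h1 (by fun_prop), integral_const_mul]

theorem outputEntropy_eq (hν2 : Integrable (fun x => ‖x‖ ^ 2) ν) (r : ℝ) :
    outputEntropy ν r
      = ∫ p : E × E, Real.log (evidence ν r (r • p.1 + p.2)) ∂(ν.prod (stdGaussian E)) := by
  have h := (integrable_log_evidence hν2 r).aestronglyMeasurable
  rw [outputEntropy, channelLaw] at *
  rw [integral_map (by fun_prop) h]

/-- With `m` the posterior mean, Bayes gives `𝔼⟨Y, m⟩ = 𝔼⟨Y, X⟩ = r 𝔼‖X‖²` and `𝔼⟨X, m⟩ = 𝔼‖m‖²`.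
The posterior second moment averages to `𝔼‖X‖²` and cancels the first term. -/
theorem integral_deriv_log_evidence (hν2 : Integrable (fun x => ‖x‖ ^ 2) ν) (r : ℝ) :
    ∫ p, (inner ℝ (p.2 + r • p.1) (postAvg ν r id p.2)
        - r * postAvg ν r (fun w => ‖w‖ ^ 2) p.2) ∂(channelLaw ν r) = r * postEnergy ν r := by
  have hQ := integrable_postAvg (r := r) hν2 (by fun_prop)
  have hA := integrable_norm_sq_postAvg (r := r) hν2
  have hX := integrable_comp_fst_channelLaw (r := r) hν2
  have hY : Integrable (fun p : E × E => ‖p.2‖ ^ 2) (channelLaw ν r) :=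
    integrable_channelLaw_of_le hν2 (by fun_prop) (A := 0) (B := 0) (C := 1)
      (fun p => by simp) zero_le_one
  have hcs : ∀ a b : E, |inner ℝ a b| ≤ ‖a‖ ^ 2 + ‖b‖ ^ 2 := by
    intro a b
    have h1 := abs_real_inner_le_norm a b
    nlinarith [sq_nonneg (‖a‖ - ‖b‖), sq_nonneg ‖a‖, sq_nonneg ‖b‖]
  have hYm : Integrable (fun p : E × E => inner ℝ p.2 (postAvg ν r id p.2)) (channelLaw ν r) :=
    (hY.add hA).mono' (Measurable.aestronglyMeasurable (by fun_prop))
      (Filter.Eventually.of_forall fun p => hcs _ _)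
  have hXm : Integrable (fun p : E × E => inner ℝ (postAvg ν r id p.2) p.1) (channelLaw ν r) :=
    (hA.add hX).mono' (Measurable.aestronglyMeasurable (by fun_prop))
      (Filter.Eventually.of_forall fun p => hcs _ _)
  obtain ⟨hXY, hXYe⟩ := integral_inner_channelLaw (r := r) hν2
  have hXY' : Integrable (fun p : E × E => inner ℝ p.2 p.1) (channelLaw ν r) := by
    simpa only [real_inner_comm] using hXY
  have e1 : ∫ p, inner ℝ p.2 (postAvg ν r id p.2) ∂(channelLaw ν r) = r * ∫ x, ‖x‖ ^ 2 ∂ν := by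
    rw [← hXYe, integral_comp_snd_channelLaw (g := fun y => inner ℝ y (postAvg ν r id y)) hYm]
    simp_rw [fun p : E × E => real_inner_comm p.2 p.1]
    rw [integral_channelLaw_eq_postAvg hXY']
    congr with y
    rw [inner_postAvg hν2]
  have e2 : ∫ p, inner ℝ (postAvg ν r id p.2) p.1 ∂(channelLaw ν r) = postEnergy ν r := by
    rw [postEnergy_eq hν2, integral_channelLaw_eq_postAvg hXm]
    congr with y
    rw [← real_inner_self_eq_norm_sq, inner_postAvg hν2 (postAvg ν r id y) y]
  have e3 : ∀ p : E × E, inner ℝ (p.2 + r • p.1) (postAvg ν r id p.2)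
        - r * postAvg ν r (fun w => ‖w‖ ^ 2) p.2
      = inner ℝ p.2 (postAvg ν r id p.2) + r * inner ℝ (postAvg ν r id p.2) p.1
        - r * postAvg ν r (fun w => ‖w‖ ^ 2) p.2 := by
    intro p
    rw [inner_add_left, inner_smul_left, real_inner_comm p.1]
    rfl
  simp_rw [e3]
  rw [integral_sub (by fun_prop) (by fun_prop), integral_add (by fun_prop) (by fun_prop),
    integral_const_mul, integral_const_mul, e1, e2, integral_postAvg hν2 (by fun_prop)]
  ring

theorem hasDerivAt_outputEntropy (hν2 : Integrable (fun x => ‖x‖ ^ 2) ν) (hr : 0 < r) :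
    HasDerivAt (outputEntropy ν) (r * postEnergy ν r) r := by
  obtain ⟨hx2, hz2⟩ := integrable_fst_snd_norm_sq hν2
  set M := ∫ x, ‖x‖ ^ 2 ∂ν with hM
  have hball : ∀ s ∈ Metric.ball r (r / 2), r / 2 ≤ s ∧ s ≤ 2 * r := by
    intro s hs
    rw [Metric.mem_ball, Real.dist_eq, abs_lt] at hs
    constructor <;> linarith
  have hmQ : ∀ s, Measurable (postAvg ν s (fun w => ‖w‖ ^ 2)) := fun s =>
    (stronglyMeasurable_postAvg (Measurable.stronglyMeasurable (by fun_prop))).measurable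
  have hlogi : Integrable (fun p : E × E => Real.log (evidence ν r (r • p.1 + p.2)))
      (ν.prod (stdGaussian E)) := by
    have h := integrable_log_evidence hν2 r
    rw [channelLaw, integrable_map_measure
      (Measurable.aestronglyMeasurable (by fun_prop)) (by fun_prop)] at h
    exact h
  have hmain := (hasDerivAt_integral_of_dominated_loc_of_deriv_le
    (μ := ν.prod (stdGaussian E))
    (F := fun s (p : E × E) => Real.log (evidence ν s (s • p.1 + p.2)))
    (F' := fun s (p : E × E) => inner ℝ (s • p.1 + p.2 + s • p.1) (postAvg ν s id (s • p.1 + p.2))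
        - s * postAvg ν s (fun w => ‖w‖ ^ 2) (s • p.1 + p.2))
    -- The first bracket bounds the posterior second moment: `postAvg_norm_sq_le` divided by `s²`,
    -- with `s ≥ r / 2`; positivity of `r` matters here. The rest bounds `‖2 s x + z‖² / 2` with `s
    -- ≤ 2 r`.
    (bound := fun p => (1 / 2 + 2 * r) * (16 * ‖p.1‖ ^ 2 + 64 / r ^ 2 * ‖p.2‖ ^ 2 + 3 * M)
      + (16 * r ^ 2 * ‖p.1‖ ^ 2 + ‖p.2‖ ^ 2))
    (Metric.ball_mem_nhds r (half_pos hr))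
    (Filter.Eventually.of_forall fun s => Measurable.aestronglyMeasurable (by fun_prop)) hlogi
    (Measurable.aestronglyMeasurable (by fun_prop))
    (Filter.Eventually.of_forall fun p s hs => ?_) ?_
    (Filter.Eventually.of_forall fun p s _ => ?_)).2
  · have h1 : outputEntropy ν
        = fun s => ∫ p : E × E, Real.log (evidence ν s (s • p.1 + p.2)) ∂(ν.prod (stdGaussian E)) :=
      funext fun s => outputEntropy_eq hν2 s
    rw [h1]
    refine hmain.congr_deriv ?_
    rw [← integral_deriv_log_evidence hν2 r, channelLaw, integral_map (by fun_prop)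
      (Measurable.aestronglyMeasurable (by fun_prop))]
  · obtain ⟨hs1, hs2⟩ := hball s hs
    have hs0 : 0 < s := by linarith
    set y := s • p.1 + p.2 with hy
    set Q := postAvg ν s (fun w => ‖w‖ ^ 2) y with hQ
    have hQ0 : 0 ≤ Q := integral_nonneg fun w => sq_nonneg _
    have hmQ' : ‖postAvg ν s id y‖ ^ 2 ≤ Q := norm_sq_postAvg_le hν2 y
    have hQle := postAvg_norm_sq_le hν2 s y
    have hyle := norm_smul_add_sq_le s p.1 p.2
    have hyxle := norm_smul_add_sq_le (2 * s) p.1 p.2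
    have e1 : (2 * s) • p.1 + p.2 = y + s • p.1 := by rw [hy]; module
    rw [e1] at hyxle
    rw [← hy] at hyle
    rw [← hM, ← hQ] at hQle
    have hQ2 : Q ≤ 16 * ‖p.1‖ ^ 2 + 64 / r ^ 2 * ‖p.2‖ ^ 2 + 3 * M := by
      have h3 : s ^ 2 * Q ≤ s ^ 2 * (16 * ‖p.1‖ ^ 2 + 16 / s ^ 2 * ‖p.2‖ ^ 2 + 3 * M) := by
        have h4 : s ^ 2 * (16 / s ^ 2 * ‖p.2‖ ^ 2) = 16 * ‖p.2‖ ^ 2 := by field_simp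
        linarith
      have h5 := le_of_mul_le_mul_left h3 (by positivity)
      have h6 : 16 / s ^ 2 ≤ 64 / r ^ 2 := by
        rw [div_le_div_iff₀ (by positivity) (by positivity)]
        nlinarith
      have h7 : 16 / s ^ 2 * ‖p.2‖ ^ 2 ≤ 64 / r ^ 2 * ‖p.2‖ ^ 2 := by gcongr
      linarith
    have hin : |inner ℝ (y + s • p.1) (postAvg ν s id y)|
        ≤ 1 / 2 * ‖y + s • p.1‖ ^ 2 + 1 / 2 * Q := by
      have h1 := abs_real_inner_le_norm (y + s • p.1) (postAvg ν s id y)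
      nlinarith [sq_nonneg (‖y + s • p.1‖ - ‖postAvg ν s id y‖)]
    have hs2' : s ^ 2 * ‖p.1‖ ^ 2 ≤ 4 * r ^ 2 * ‖p.1‖ ^ 2 := by
      have : s ^ 2 ≤ 4 * r ^ 2 := by nlinarith
      gcongr
    rw [Real.norm_eq_abs]
    refine (abs_sub _ _).trans ?_
    rw [abs_mul, abs_of_pos hs0, abs_of_nonneg hQ0]
    have h8 : s * Q ≤ 2 * r * Q := by gcongr
    have h9 : (1 / 2 + 2 * r) * Q
        ≤ (1 / 2 + 2 * r) * (16 * ‖p.1‖ ^ 2 + 64 / r ^ 2 * ‖p.2‖ ^ 2 + 3 * M) := by gcongr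
    have h10 : (2 * s) ^ 2 * ‖p.1‖ ^ 2 = 4 * (s ^ 2 * ‖p.1‖ ^ 2) := by ring
    linarith
  · fun_prop
  · exact hasDerivAt_log_evidence hν2 p.1 p.2 s

/-- The mutual information between the signal and its noisy observation. -/
noncomputable def channelInfo (ν : Measure E) (r : ℝ) : ℝ :=
  r ^ 2 * (∫ x, ‖x‖ ^ 2 ∂ν) / 2 - outputEntropy ν r

/-- The I-MMSE formula. -/
theorem hasDerivAt_channelInfo (hν2 : Integrable (fun x => ‖x‖ ^ 2) ν) (hr : 0 < r) :
    HasDerivAt (channelInfo ν) (r * mmse ν r) r := by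
  have h := (((hasDerivAt_pow 2 r).mul_const (∫ x, ‖x‖ ^ 2 ∂ν)).div_const 2).sub
    (hasDerivAt_outputEntropy hν2 hr)
  refine h.congr_deriv ?_
  rw [mmse]
  push_cast
  ring

end Information

/-! ### Relative entropy of the channel. -/

section MutualInformation

variable {E : Type*} [NormedAddCommGroup E] [InnerProductSpace ℝ E] [FiniteDimensional ℝ E]
  [MeasurableSpace E] [BorelSpace E] {ν : Measure E} [IsProbabilityMeasure ν]

theorem snd_channelLaw (ν : Measure E) [IsProbabilityMeasure ν] (r : ℝ) :
    (channelLaw ν r).snd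
      = (stdGaussian E).withDensity (fun y => ENNReal.ofReal (evidence ν r y)) := by
  refine Measure.ext_of_lintegral _ fun g hg => ?_
  rw [Measure.snd, lintegral_map hg measurable_snd, channelLaw_eq_withDensity,
    lintegral_withDensity_eq_lintegral_mul _ (by fun_prop) (by fun_prop),
    lintegral_withDensity_eq_lintegral_mul _ (by fun_prop) hg,
    lintegral_prod_symm' _ (by fun_prop)]
  refine lintegral_congr fun y => ?_
  simp only [Pi.mul_apply]
  rw [lintegral_mul_const _ (by fun_prop), evidence,
    ofReal_integral_eq_lintegral_ofReal (integrable_exp_logLik r y)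
      (Filter.Eventually.of_forall fun x => Real.exp_nonneg _)]

theorem channelLaw_eq_withDensity_prod (ν : Measure E) [IsProbabilityMeasure ν] (r : ℝ) :
    channelLaw ν r = (ν.prod (channelLaw ν r).snd).withDensity
      (fun p => ENNReal.ofReal (Real.exp (logLik r p.2 p.1 - Real.log (evidence ν r p.2)))) := by
  rw [snd_channelLaw, prod_withDensity_right (by fun_prop), ← withDensity_mul _ (by fun_prop)
    (by fun_prop), channelLaw_eq_withDensity]
  congr with p
  rw [Pi.mul_apply, ← ENNReal.ofReal_mul (evidence_pos ν r p.2).le, Real.exp_sub,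
    Real.exp_log (evidence_pos ν r p.2), mul_div_cancel₀ _ (evidence_pos ν r p.2).ne']

/-- The density of the joint law against the product is likelihood over evidence. The mean
log-likelihood is `r² 𝔼‖X‖² - r² 𝔼‖X‖² / 2`, and the mean log-evidence is the output entropy. -/
theorem klDiv_channelLaw (hν2 : Integrable (fun x => ‖x‖ ^ 2) ν) (r : ℝ) :
    InformationTheory.klDiv (channelLaw ν r) (ν.prod (channelLaw ν r).snd)
      = ENNReal.ofReal (channelInfo ν r) := by
  have hac : channelLaw ν r ≪ ν.prod (channelLaw ν r).snd := by
    have h1 := withDensity_absolutelyContinuous (ν.prod (channelLaw ν r).snd)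
      (fun p => ENNReal.ofReal (Real.exp (logLik r p.2 p.1 - Real.log (evidence ν r p.2))))
    rwa [← channelLaw_eq_withDensity_prod] at h1
  have hrn : llr (channelLaw ν r) (ν.prod (channelLaw ν r).snd) =ᵐ[channelLaw ν r]
      fun p => logLik r p.2 p.1 - Real.log (evidence ν r p.2) := by
    have h1 : (channelLaw ν r).rnDeriv (ν.prod (channelLaw ν r).snd)
        =ᵐ[ν.prod (channelLaw ν r).snd] fun p =>
          ENNReal.ofReal (Real.exp (logLik r p.2 p.1 - Real.log (evidence ν r p.2))) := by
      have h2 := Measure.rnDeriv_withDensity (ν.prod (channelLaw ν r).snd)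
        (f := fun p => ENNReal.ofReal (Real.exp (logLik r p.2 p.1 - Real.log (evidence ν r p.2))))
        (by fun_prop)
      rwa [← channelLaw_eq_withDensity_prod] at h2
    filter_upwards [hac.ae_le h1] with p hp
    rw [llr, hp, ENNReal.toReal_ofReal (Real.exp_nonneg _), Real.log_exp]
  obtain ⟨hXY, hXYe⟩ := integral_inner_channelLaw (r := r) hν2
  have hX := integrable_comp_fst_channelLaw (r := r) hν2
  have hlog := integrable_log_evidence hν2 r
  have hint : Integrable (fun p : E × E => logLik r p.2 p.1 - Real.log (evidence ν r p.2))
      (channelLaw ν r) := by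
    unfold logLik
    fun_prop
  rw [InformationTheory.klDiv_of_ac_of_integrable hac ((integrable_congr hrn).2 hint),
    integral_congr_ae hrn]
  congr 1
  simp only [probReal_univ, add_sub_cancel_right]
  have hlik : Integrable (fun p : E × E => logLik r p.2 p.1) (channelLaw ν r) := by
    unfold logLik
    fun_prop
  have e1 : ∫ p, logLik r p.2 p.1 ∂(channelLaw ν r) = r ^ 2 * (∫ x, ‖x‖ ^ 2 ∂ν) / 2 := by
    unfold logLik
    rw [integral_sub (by fun_prop) (by fun_prop), integral_const_mul, integral_div,
      integral_const_mul, hXYe, integral_comp_fst_channelLaw (q := fun x => ‖x‖ ^ 2) hν2]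
    ring
  rw [integral_sub hlik hlog, e1, channelInfo, outputEntropy]

/-- Data processing in both directions. -/
theorem klDiv_map_measurableEquiv {S T : Type*} [MeasurableSpace S] [MeasurableSpace T]
    (P Q : Measure S) [IsFiniteMeasure P] [IsFiniteMeasure Q] (e : S ≃ᵐ T) :
    InformationTheory.klDiv (P.map e) (Q.map e) = InformationTheory.klDiv P Q := by
  refine le_antisymm (InformationTheory.klDiv_map_le P Q e.measurable) ?_
  have h := InformationTheory.klDiv_map_le (P.map e) (Q.map e) e.symm.measurable
  rwa [e.map_symm_map, e.map_symm_map] at h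

end MutualInformation

/-! ### The Ornstein-Uhlenbeck flow as a Gaussian channel. -/

section OrnsteinUhlenbeck

variable {n : ℕ} {Ω : Type*} [MeasurableSpace Ω] {P : Measure Ω} [IsProbabilityMeasure P]
  {α : ℝ} {X : ℝ≥0 → Ω → EuclideanSpace ℝ (Fin n)}

theorem IsOUProcess.map_prod (hX : IsOUProcess α X P) (t : ℝ≥0) :
    P.map (fun ω => (X 0 ω, X t ω)) = (P.map (X 0)) ⊗ₘ (ouKernel n α t) := by
  have h := (hX.markov 0 t).comp_right.map_eq
  rw [zero_add] at h
  exact h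

/-- The signal-to-noise ratio of the Ornstein-Uhlenbeck flow at time `t`. -/
noncomputable def ouSNR (α t : ℝ) : ℝ := α / (Real.exp (2 * α * t) - 1)

theorem ouSNR_pos (hα : 0 < α) {t : ℝ} (ht : 0 < t) : 0 < ouSNR α t := by
  have : 1 < Real.exp (2 * α * t) := Real.one_lt_exp_iff.2 (by positivity)
  exact div_pos hα (by linarith)

theorem hasDerivAt_ouSNR (hα : 0 < α) {t : ℝ} (ht : 0 < t) :
    HasDerivAt (ouSNR α) (-2 * ouSNR α t * (ouSNR α t + α)) t := by
  have h1 : 1 < Real.exp (2 * α * t) := Real.one_lt_exp_iff.2 (by positivity)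
  have h2 : Real.exp (2 * α * t) - 1 ≠ 0 := by linarith
  have h3 := ((hasDerivAt_id t).const_mul (2 * α)).exp.sub_const 1
  refine ((hasDerivAt_const t α).div h3 h2).congr_deriv ?_
  simp only [id, ouSNR]
  field_simp
  ring

theorem ouSNR_antitoneOn (hα : 0 < α) : AntitoneOn (ouSNR α) (Set.Ioi 0) := by
  intro s hs t ht hst
  have h1 : 1 < Real.exp (2 * α * s) := Real.one_lt_exp_iff.2 (by have : 0 < s := hs; positivity)
  unfold ouSNR
  gcongr

theorem compProd_ouKernel_eq_map (hα : 0 < α) {t : ℝ≥0} (ht : 0 < t)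
    (μ : Measure (EuclideanSpace ℝ (Fin n))) [IsProbabilityMeasure μ] :
    μ ⊗ₘ (ouKernel n α t) = (channelLaw μ (√(ouSNR α t))).map
      (Prod.map id (fun y => √((1 - Real.exp (-2 * α * t)) / α) • y)) := by
  have ht' : (0 : ℝ) < t := ht
  have hE : 1 < Real.exp (2 * α * t) := Real.one_lt_exp_iff.2 (by positivity)
  -- Noise level times channel gain is the drift factor: this is what determines `ouSNR`.
  have h1 : √((1 - Real.exp (-2 * α * t)) / α) * √(ouSNR α t) = Real.exp (-α * t) := by
    rw [← Real.sqrt_mul' _ (ouSNR_pos hα ht').le, ouSNR, Real.sqrt_eq_iff_mul_self_eq_of_pos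
      (Real.exp_pos _), ← Real.exp_add]
    have h3 : Real.exp (-2 * α * t) = (Real.exp (2 * α * t))⁻¹ := by
      rw [← Real.exp_neg]; ring_nf
    have h4 : Real.exp (-α * t + -α * t) = (Real.exp (2 * α * t))⁻¹ := by
      rw [← Real.exp_neg]; ring_nf
    rw [h3, h4]
    have h5 : Real.exp (2 * α * t) - 1 ≠ 0 := by linarith
    field_simp
  refine Measure.ext_of_lintegral _ fun g hg => ?_
  rw [Measure.lintegral_compProd hg, lintegral_map hg (by fun_prop), channelLaw,
    lintegral_map (by fun_prop) (by fun_prop), lintegral_prod _ (by fun_prop)]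
  refine lintegral_congr fun x => ?_
  change ∫⁻ y, g (x, y) ∂(ouLaw α t x) = _
  rw [ouLaw, lintegral_map (by fun_prop) (by fun_prop)]
  refine lintegral_congr fun z => ?_
  simp only [Prod.map_apply, id, smul_add, smul_smul, h1]

/-- Rescaling the observation by the noise level, nonzero for `t > 0`, is invertible and does not
change the relative entropy. -/
theorem IsOUProcess.mutualInfo_eq (hX : IsOUProcess α X P) (hα : 0 < α)
    (hX2 : Integrable (fun x => ‖x‖ ^ 2) (P.map (X 0))) {t : ℝ≥0} (ht : 0 < t) :
    mutualInfo (X 0) (X t) P = ENNReal.ofReal (channelInfo (P.map (X 0)) (√(ouSNR α t))) := by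
  have hμ : IsProbabilityMeasure (P.map (X 0)) :=
    Measure.isProbabilityMeasure_map (hX.measurable 0).aemeasurable
  have hσ : √((1 - Real.exp (-2 * α * t)) / α) ≠ 0 := by
    have ht' : (0 : ℝ) < t := ht
    have : Real.exp (-2 * α * t) < 1 := Real.exp_lt_one_iff.2 (by nlinarith [mul_pos hα ht'])
    exact (Real.sqrt_pos.2 (div_pos (by linarith) hα)).ne'
  set e := MeasurableEquiv.prodCongr (MeasurableEquiv.refl (EuclideanSpace ℝ (Fin n)))
    (MeasurableEquiv.smul₀ (√((1 - Real.exp (-2 * α * t)) / α)) hσ :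
      EuclideanSpace ℝ (Fin n) ≃ᵐ EuclideanSpace ℝ (Fin n)) with he
  have hjoint : P.map (fun ω => (X 0 ω, X t ω))
      = (channelLaw (P.map (X 0)) (√(ouSNR α t))).map e := by
    rw [hX.map_prod, compProd_ouKernel_eq_map hα ht]
    rfl
  have hsnd : P.map (X t) = (channelLaw (P.map (X 0)) (√(ouSNR α t))).snd.map
      (MeasurableEquiv.smul₀ (√((1 - Real.exp (-2 * α * t)) / α)) hσ) := by
    have h1 : P.map (X t) = (P.map (fun ω => (X 0 ω, X t ω))).map Prod.snd := by
      rw [Measure.map_map measurable_snd ((hX.measurable 0).prodMk (hX.measurable t))]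
      rfl
    rw [h1, hjoint, Measure.snd, Measure.map_map measurable_snd e.measurable,
      Measure.map_map (MeasurableEquiv.measurable _) measurable_snd]
    rfl
  rw [mutualInfo, hjoint, hsnd, ← klDiv_channelLaw hX2]
  have hprod := Measure.map_prod_map (P.map (X 0)) (channelLaw (P.map (X 0)) (√(ouSNR α t))).snd
    measurable_id (MeasurableEquiv.smul₀ (√((1 - Real.exp (-2 * α * t)) / α)) hσ :
      EuclideanSpace ℝ (Fin n) ≃ᵐ EuclideanSpace ℝ (Fin n)).measurable
  rw [Measure.map_id] at hprod
  rw [hprod]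
  exact klDiv_map_measurableEquiv _ _ e

/-- By the I-MMSE formula and the chain rule the derivative is `-s(s + α) mmse(√s)`, where `s =
ouSNR α t` decreases in `t`. It is monotone in `t` because `s(s + α) mmse(√s)` is nondecreasing in
`s`. -/
theorem convexOn_channelInfo_ouSNR (hα : 0 < α) {lam : ℝ} (hlam : 0 < lam)
    {μ : Measure (EuclideanSpace ℝ (Fin n))} [IsProbabilityMeasure μ]
    (hμ : IsMidpointLogConcave lam μ) :
    ConvexOn ℝ (Set.Ioi 0) (fun t => channelInfo μ (√(ouSNR α t))) := by
  have hμ2 := hμ.integrable_norm_sq hlam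
  have hderiv : ∀ t ∈ Set.Ioi (0 : ℝ), HasDerivAt (fun t => channelInfo μ (√(ouSNR α t)))
      (-(ouSNR α t * (ouSNR α t + α) * mmse μ (√(ouSNR α t)))) t := by
    intro t ht
    have hs := ouSNR_pos hα ht
    have h1 := (hasDerivAt_ouSNR hα ht).sqrt hs.ne'
    refine ((hasDerivAt_channelInfo hμ2 (Real.sqrt_pos.2 hs)).comp t h1).congr_deriv ?_
    have := (Real.sqrt_pos.2 hs).ne'
    field_simp
  refine MonotoneOn.convexOn_of_deriv (convex_Ioi 0)
    (fun t ht => (hderiv t ht).continuousAt.continuousWithinAt)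
    (fun t ht => (hderiv t (interior_subset ht)).differentiableAt.differentiableWithinAt) ?_
  rw [interior_Ioi]
  intro t ht u hu htu
  rw [(hderiv t ht).deriv, (hderiv u hu).deriv, neg_le_neg_iff]
  have hsu := ouSNR_pos hα hu
  have hst := ouSNR_pos hα ht
  have hanti := ouSNR_antitoneOn hα ht hu htu
  generalize ouSNR α u = s at *
  generalize ouSNR α t = q at *
  have h1 := hμ.mul_mmse_le hlam (Real.sqrt_nonneg s) (Real.sqrt_le_sqrt hanti)
  rw [Real.sq_sqrt hsu.le, Real.sq_sqrt hst.le] at h1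
  have h2 : s / (lam + s) ≤ q / (lam + q) := by
    rw [div_le_div_iff₀ (by positivity) (by positivity)]
    nlinarith
  have hm1 := mmse_nonneg hμ2 (√s)
  have hm2 := mmse_nonneg hμ2 (√q)
  -- Each of the three factors is nonnegative and nondecreasing in the signal-to-noise ratio.
  calc s * (s + α) * mmse μ (√s) = s / (lam + s) * (s + α) * ((lam + s) * mmse μ (√s)) := by
        field_simp
    _ ≤ q / (lam + q) * (q + α) * ((lam + q) * mmse μ (√q)) := by gcongr
    _ = q * (q + α) * mmse μ (√q) := by field_simp

/-- The joint law lives on the diagonal, which is null for the product as the marginal has no atoms.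
-/
theorem mutualInfo_self_eq_top {S : Type*} [MeasurableSpace S] [MeasurableEq S] {Y : Ω → S}
    (hY : Measurable Y) [NullSingletonClass (P.map Y)] : mutualInfo Y Y P = ∞ := by
  refine InformationTheory.klDiv_of_not_ac fun hac => ?_
  have h1 : ((P.map Y).prod (P.map Y)) (Set.diagonal S) = 0 := by
    have hfin : IsProbabilityMeasure (P.map Y) := Measure.isProbabilityMeasure_map hY.aemeasurable
    have hfib : ∀ x : S, Prod.mk x ⁻¹' Set.diagonal S = {x} := fun x => by
      ext y; simp [eq_comm]
    simp only [Measure.prod_apply measurableSet_diagonal, hfib, measure_singleton, lintegral_zero]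
  have h2 := hac h1
  rw [Measure.map_apply (hY.prodMk hY) measurableSet_diagonal] at h2
  have h3 : (fun ω => (Y ω, Y ω)) ⁻¹' Set.diagonal S = Set.univ := by
    ext ω; simp
  rw [h3, measure_univ] at h2
  exact one_ne_zero h2

theorem mutualInfo_of_subsingleton {S T : Type*} [MeasurableSpace S] [MeasurableSpace T]
    [Subsingleton S] [Subsingleton T] {Y : Ω → S} {Z : Ω → T} (hY : Measurable Y)
    (hZ : Measurable Z) : mutualInfo Y Z P = 0 := by
  have h1 : IsProbabilityMeasure (P.map Y) := Measure.isProbabilityMeasure_map hY.aemeasurable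
  have h2 : IsProbabilityMeasure (P.map Z) := Measure.isProbabilityMeasure_map hZ.aemeasurable
  have h3 : IsProbabilityMeasure (P.map (fun ω => (Y ω, Z ω))) :=
    Measure.isProbabilityMeasure_map (hY.prodMk hZ).aemeasurable
  rw [mutualInfo, InformationTheory.klDiv_eq_zero_iff]
  ext s -
  rcases Set.eq_empty_or_nonempty s with rfl | hs
  · simp
  · rw [Subsingleton.eq_univ_of_nonempty hs]
    simp

end OrnsteinUhlenbeck

theorem theorem1 {n : ℕ} {Ω : Type*} [MeasurableSpace Ω] (P : Measure Ω) [IsProbabilityMeasure P]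
    (α lam : ℝ) (hα : 0 < α) (hlam : 0 < lam)
    (X : ℝ≥0 → Ω → EuclideanSpace ℝ (Fin n)) (hX : IsOUProcess α X P)
    (hX0 : IsStronglyLogConcave lam (P.map (X 0))) :
    (∀ t : ℝ≥0, 0 < t → mutualInfo (X 0) (X t) P ≠ ∞) ∧
    ConvexOn ℝ≥0 {t : ℝ≥0 | convexityTime α lam ≤ t} (fun t => mutualInfo (X 0) (X t) P) := by
  have hμ : IsProbabilityMeasure (P.map (X 0)) :=
    Measure.isProbabilityMeasure_map (hX.measurable 0).aemeasurable
  have hlc := hX0.isMidpointLogConcave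
  have hX2 := hlc.integrable_norm_sq hlam
  have heq : ∀ t : ℝ≥0, 0 < t → mutualInfo (X 0) (X t) P
      = ENNReal.ofReal (channelInfo (P.map (X 0)) (√(ouSNR α t))) :=
    fun t ht => hX.mutualInfo_eq hα hX2 ht
  refine ⟨fun t ht => heq t ht ▸ ENNReal.ofReal_ne_top, ?_, ?_⟩
  · intro x hx y hy a b _ _ hab
    simp only [Set.mem_ofPred_eq] at hx hy ⊢
    have hab' : (a : ℝ) + b = 1 := by exact_mod_cast hab
    simp only [smul_eq_mul, NNReal.coe_add, NNReal.coe_mul]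
    calc convexityTime α lam = a * convexityTime α lam + b * convexityTime α lam := by
          rw [← add_mul, hab', one_mul]
      _ ≤ a * x + b * y := by gcongr
  intro x _ y _ a b _ _ hab
  -- Zero weights go first: below, a weight multiplies the value `∞` at time `0`, and `0 * ∞ = 0`.
  rcases eq_or_ne a 0 with rfl | ha
  · obtain rfl : b = 1 := by simpa using hab
    simp
  rcases eq_or_ne b 0 with rfl | hb
  · obtain rfl : a = 1 := by simpa using hab
    simp
  -- In dimension zero the law of `X 0` is an atom and the information vanishes at all times,
  -- including `0`.
  rcases Nat.eq_zero_or_pos n with rfl | hn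
  · have h0 : ∀ t, mutualInfo (X 0) (X t) P = 0 := fun t =>
      mutualInfo_of_subsingleton (hX.measurable 0) (hX.measurable t)
    simp [h0]
  have htop : mutualInfo (X 0) (X 0) P = ∞ := by
    obtain ⟨ρ, -, hρ, -⟩ := hX0
    have : Nonempty (Fin n) := ⟨⟨0, hn⟩⟩
    have hna : NullSingletonClass (P.map (X 0)) := by
      refine ⟨fun x => ?_⟩
      rw [hρ]
      exact withDensity_absolutelyContinuous _ _ (measure_singleton x)
    exact mutualInfo_self_eq_top (hX.measurable 0)
  -- If an endpoint is time `0`, the right side is infinite.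
  rcases eq_or_ne x 0 with rfl | hx
  · simp only [htop]
    rw [ENNReal.smul_top, if_neg ha, top_add]
    exact le_top
  rcases eq_or_ne y 0 with rfl | hy
  · simp only [htop]
    rw [ENNReal.smul_top, if_neg hb, add_top]
    exact le_top
  have hx0 : 0 < x := pos_iff_ne_zero.2 hx
  have hy0 : 0 < y := pos_iff_ne_zero.2 hy
  have hab' : (a : ℝ) + b = 1 := by exact_mod_cast hab
  have hconv := (convexOn_channelInfo_ouSNR hα hlam hlc).2
    (show (x : ℝ) ∈ Set.Ioi 0 from hx0) (show (y : ℝ) ∈ Set.Ioi 0 from hy0) a.2 b.2 hab'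
  have hxy : 0 < a • x + b • y :=
    add_pos_of_pos_of_nonneg (mul_pos (pos_iff_ne_zero.2 ha) hx0) zero_le
  simp only [heq x hx0, heq y hy0, heq _ hxy]
  rw [ENNReal.smul_def a, ENNReal.smul_def b,
    ← ENNReal.ofReal_coe_nnreal (p := a), ← ENNReal.ofReal_coe_nnreal (p := b)]
  simp only [smul_eq_mul (α := ℝ≥0∞)]
  rw [← ENNReal.ofReal_mul a.coe_nonneg, ← ENNReal.ofReal_mul b.coe_nonneg]
  refine (ENNReal.ofReal_le_ofReal ?_).trans ENNReal.ofReal_add_le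
  exact hconv
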